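/- **(Double Excision)** Let $R$ be a commutative ring with $1$, $I\subseteq R$ an ideal, and $n\ge 3$. *Notation.* $\mathrm{Um}_n(R)$ is the set of rows $v\in R^n$ with $v\,w^t=1$ for some $w\in R^n$, and $\mathrm{Um}_n(R,I)$ is the set of those $v\in\mathrm{Um}_n(R)$ with $v\equiv e_1=(1,0,\dots,0)\pmod I$. $\mathrm E_n(R)\subseteq \mathrm{GL}_n(R)$ is the subgroup generated by the elementary matrices $E_{ij}(c)$, $i\ne j$, $c\in R$, and $\mathrm E_n(R,I)$ is the smallest normal subgroup of $\mathrm E_n(R)$ containing all $E_{21}(x)$, $x\in I$. These groups act by right multiplication; put $\mathrm{MSE}_n(R)=\mathrm{Um}_n(R)/\mathrm E_n(R)$ and $\mathrm{MSE}_n(R,I)=\mathrm{Um}_n(R,I)/\mathrm E_n(R,I)$. For $A=\mathbb Z$ or $A=R$ the excision ring $A\oplus I$ has coordinatewise addition and the product $(r,i)(s,j)=(rs,\,rj+si+ij)$, and $0\oplus I$ is its ideal of elements with first coordinate $0$. Let $f:\mathbb Z\oplus I\to R$, $f(m,i)=m+i$, let $\pi_2:R\oplus I\to R$, $\pi_2(a,i)=a+i$,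 and let $\varphi:\mathbb Z\oplus(0\oplus I)\to\mathbb Z\oplus I$, $\varphi(m,(0,i))=(m,i)$, where in $\mathbb Z\oplus(0\oplus I)$ the set $0\oplus I$ is regarded as an ideal of $R\oplus I$. The map $f$ induces $F:\mathrm{MSE}_n(\mathbb Z\oplus I,0\oplus I)\to\mathrm{MSE}_n(R,I)$, and $[v]\mapsto[v]$ defines $G:\mathrm{MSE}_n(\mathbb Z\oplus I,0\oplus I)\to\mathrm{MSE}_n(\mathbb Z\oplus I)$; these constructions apply in the same way to the ideal $0\oplus I$ of $R\oplus I$. *(a)* The natural maps $$\mathrm{MSE}_n(R\oplus I,0\oplus I)\xleftarrow{F}\mathrm{MSE}_n(\mathbb Z\oplus(0\oplus I),\,0\oplus I)\xrightarrow{G}\mathrm{MSE}_n(\mathbb Z\oplus(0\oplus I))\xrightarrow{\varphi}\mathrm{MSE}_n(\mathbb Z\oplus I)\xleftarrow{G}\mathrm{MSE}_n(\mathbb Z\oplus I,0\oplus I)\xrightarrow{F}\mathrm{MSE}_n(R,I)$$ are all bijections, and so is the map $\pi_2:\mathrm{MSE}_n(R\oplus I,0\oplus I)\to\mathrm{MSE}_n(R,I)$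 induced by $\pi_2$. *(b)* An operation $*$ on $\mathrm{MSE}_n(A)$, $A$ a commutative ring, *follows the Vaserstein–van der Kallen rule* if $$[(b,a_2,\dots,a_n)]*[(a,a_2,\dots,a_n)]=[(a(b+p)-1,\;a_2(b+p),\;a_3,\dots,a_n)]$$ for all unimodular rows $(a,a_2,\dots,a_n)$, $(b,a_2,\dots,a_n)$ over $A$ and all $p\in A$ with $ap\equiv1 \pmod{(a_2,\dots,a_n)}$. An operation on $\mathrm{MSE}_n(R,I)$ follows the rule if the operation which it induces on $\mathrm{MSE}_n(\mathbb Z\oplus I)$ through the bijections $F,G$ follows it. We say that the rule *gives the product* of two classes in $\mathrm{MSE}_n(R,I)$ if the corresponding classes in $\mathrm{MSE}_n(\mathbb Z\oplus I)$ have representatives $(b,a_2,\dots,a_n)$ and $(a,a_2,\dots,a_n)$ with the same last $n-1$ coordinates. A group structure on $\mathrm{MSE}_n(R,I)$ following the rule is *nice* if $[(b,a_2,\dots,a_n)]*[(a,a_2,\dots,a_n)]=[(ab,a_2,\dots,a_n)]$ for all $(a,a_2,\dots,a_n),(b,a_2,\dots,a_n)\in\mathrm{Um}_n(R,I)$. Assume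 that $\mathrm{MSE}_n(R,I)$ and $\mathrm{MSE}_n(R\oplus I,0\oplus I)$ carry group structures that follow the Vaserstein–van der Kallen rule. Then $\pi_2(xy)=\pi_2(x)\pi_2(y)$ for all $x,y\in\mathrm{MSE}_n(R\oplus I,0\oplus I)$ whose product is given by the rule. In particular, if the rule gives the product of any two classes in $\mathrm{MSE}_n(R\oplus I,0\oplus I)$, then $\pi_2:\mathrm{MSE}_n(R\oplus I,0\oplus I)\to\mathrm{MSE}_n(R,I)$ is a group homomorphism. Moreover (without this last assumption), the group structure on $\mathrm{MSE}_n(R\oplus I,0\oplus I)$ is nice if and only if the one on $\mathrm{MSE}_n(R,I)$ is nice. -/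

import Mathlib

noncomputable section

namespace Excision

open Matrix

section OrbitSpaces

variable (n : ℕ) [NeZero n] (R : Type*) [CommRing R] (I : Ideal R)

/-- A row `v` is unimodular if `v · wᵗ = 1` for some row `w`. -/
def IsUnimodular {n : ℕ} {R : Type*} [CommRing R] (v : Fin n → R) : Prop :=
  ∃ w : Fin n → R, v ⬝ᵥ w = 1

/-- `Um_n(R)`. -/
def Um : Set (Fin n → R) := {v | IsUnimodular v}

/-- `Um_n(R, I)`: unimodular rows congruent to `e₁ = (1, 0, …, 0)` modulo `I`. -/
def UmRel : Set (Fin n → R) :=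
  {v | IsUnimodular v ∧ v 0 - 1 ∈ I ∧ ∀ i, i ≠ 0 → v i ∈ I}

/-- `E_n(R)`, the subgroup of `GL_n(R)` generated by all `E_{ij}(c)`, `i ≠ j`. -/
def elementary : Subgroup (GL (Fin n) R) :=
  Subgroup.closure {g | ∃ i j, i ≠ j ∧ ∃ c : R, (g : Matrix (Fin n) (Fin n) R) = transvection i j c}

/-- `E_n(R, I)`, the smallest normal subgroup of `E_n(R)` containing all `E_{21}(x)`, `x ∈ I`,
viewed as a subgroup of `GL_n(R)`.  (Indices start at `0`, so `E_{21}` is `transvection 1 0`.) -/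
def elementaryRel : Subgroup (GL (Fin n) R) :=
  (Subgroup.normalClosure {g : elementary n R |
    ∃ x ∈ I, ((g : GL (Fin n) R) : Matrix (Fin n) (Fin n) R) = transvection 1 0 x}).map
      (elementary n R).subtype

/-- The relation "same orbit" on a set `S` of rows, for a subgroup `H` of `GL_n(R)` acting by right
multiplication. -/
def orbitSetoid {n : ℕ} {R : Type*} [CommRing R] (S : Set (Fin n → R))
    (H : Subgroup (GL (Fin n) R)) : Setoid S where
  r v w := ∃ g ∈ H, (v : Fin n → R) ᵥ* (g : Matrix (Fin n) (Fin n) R) = w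
  iseqv :=
    { refl := fun v => ⟨1, H.one_mem, by simp⟩
      symm := by
        rintro v w ⟨g, hg, h⟩
        refine ⟨g⁻¹, H.inv_mem hg, ?_⟩
        rw [← h, Matrix.vecMul_vecMul, ← Units.val_mul, mul_inv_cancel]
        simp
      trans := by
        rintro u v w ⟨g, hg, h⟩ ⟨k, hk, h'⟩
        refine ⟨g * k, H.mul_mem hg hk, ?_⟩
        rw [Units.val_mul, ← Matrix.vecMul_vecMul, h, h'] }

/-- `MSE_n(R) = Um_n(R) / E_n(R)`. -/
def MSE : Type _ := Quotient (orbitSetoid (Um n R) (elementary n R))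

/-- `MSE_n(R, I) = Um_n(R, I) / E_n(R, I)`. -/
def MSERel : Type _ := Quotient (orbitSetoid (UmRel n R I) (elementaryRel n R I))

variable {n R I}

/-- The class `[v]` in `MSE_n(R)`. -/
def MSE.mk (v : Um n R) : MSE n R := Quotient.mk _ v

/-- The class `[v]` in `MSE_n(R, I)`. -/
def MSERel.mk (v : UmRel n R I) : MSERel n R I := Quotient.mk _ v

end OrbitSpaces

section NaturalMaps

variable {n : ℕ} {R S : Type*} [CommRing R] [CommRing S]

theorem IsUnimodular.map (f : R →+* S) {v : Fin n → R} (h : IsUnimodular v) :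
    IsUnimodular (f ∘ v) := by
  obtain ⟨w, hw⟩ := h
  refine ⟨f ∘ w, ?_⟩
  rw [← RingHom.map_dotProduct, hw, map_one]

theorem transvection_map (f : R →+* S) (i j : Fin n) (c : R) :
    (transvection i j c).map f = transvection i j (f c) := by
  ext a b
  simp only [transvection, Matrix.map_apply, Matrix.add_apply, map_add, Matrix.one_apply,
    Matrix.single_apply]
  congr 1 <;> split_ifs <;> simp

theorem elementary_map (f : R →+* S) {g : GL (Fin n) R} (hg : g ∈ elementary n R) :
    GeneralLinearGroup.map f g ∈ elementary n S := by
  have : elementary n R ≤ (elementary n S).comap (GeneralLinearGroup.map f) := by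
    refine (Subgroup.closure_le _).2 ?_
    rintro g ⟨i, j, hij, c, hc⟩
    refine Subgroup.subset_closure ⟨i, j, hij, f c, ?_⟩
    rw [← transvection_map, ← hc]
    rfl
  exact this hg

theorem elementaryRel_le [NeZero n] (I : Ideal R) : elementaryRel n R I ≤ elementary n R := by
  rintro _ ⟨g, -, rfl⟩
  exact g.2

theorem elementaryRel_map [NeZero n] (f : R →+* S) {I : Ideal R} {J : Ideal S}
    (h : I ≤ J.comap f) {g : GL (Fin n) R} (hg : g ∈ elementaryRel n R I) :
    GeneralLinearGroup.map f g ∈ elementaryRel n S J := by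
  let F : elementary n R →* elementary n S :=
    ((GeneralLinearGroup.map f).comp (elementary n R).subtype).codRestrict (elementary n S)
      (fun g => elementary_map f g.2)
  obtain ⟨g, hg, rfl⟩ := hg
  refine ⟨F g, ?_, rfl⟩
  have key : Subgroup.normalClosure {g : elementary n R | ∃ x ∈ I,
      ((g : GL (Fin n) R) : Matrix (Fin n) (Fin n) R) = transvection 1 0 x} ≤
      (Subgroup.normalClosure {g : elementary n S | ∃ x ∈ J,
      ((g : GL (Fin n) S) : Matrix (Fin n) (Fin n) S) = transvection 1 0 x}).comap F := by
    refine Subgroup.normalClosure_le_normal ?_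
    rintro g ⟨x, hx, hg⟩
    refine Subgroup.subset_normalClosure ⟨f x, h hx, ?_⟩
    rw [← transvection_map, ← hg]
    rfl
  exact key hg

theorem vecMul_map (f : R →+* S) (v : Fin n → R) (g : GL (Fin n) R) :
    (f ∘ v) ᵥ* (GeneralLinearGroup.map f g : Matrix (Fin n) (Fin n) S) =
      f ∘ (v ᵥ* (g : Matrix (Fin n) (Fin n) R)) := by
  funext i
  simp [RingHom.map_vecMul]

/-- The map `[(aᵢ)] ↦ [(f aᵢ)]` on absolute orbit spaces. -/
def MSE.map (n : ℕ) (f : R →+* S) : MSE n R → MSE n S :=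
  Quotient.map (fun v => ⟨f ∘ v.1, IsUnimodular.map f v.2⟩) (by
    rintro ⟨v, hv⟩ ⟨w, hw⟩ ⟨g, hg, h⟩
    refine ⟨GeneralLinearGroup.map f g, elementary_map f hg, ?_⟩
    change v ᵥ* (g : Matrix (Fin n) (Fin n) R) = w at h
    change (f ∘ v) ᵥ* _ = f ∘ w
    rw [vecMul_map, h])

/-- The map `[(aᵢ)] ↦ [(f aᵢ)]` on relative orbit spaces, when `f` maps `I` into `J`. -/
def MSERel.map (n : ℕ) [NeZero n] (f : R →+* S) {I : Ideal R} {J : Ideal S}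
    (hf : I ≤ J.comap f) : MSERel n R I → MSERel n S J :=
  Quotient.map (fun v => ⟨f ∘ v.1, IsUnimodular.map f v.2.1,
      by simpa using hf v.2.2.1, fun i hi => hf (v.2.2.2 i hi)⟩) (by
    rintro ⟨v, hv⟩ ⟨w, hw⟩ ⟨g, hg, h⟩
    refine ⟨GeneralLinearGroup.map f g, elementaryRel_map f hf hg, ?_⟩
    change v ᵥ* (g : Matrix (Fin n) (Fin n) R) = w at h
    change (f ∘ v) ᵥ* _ = f ∘ w
    rw [vecMul_map, h])

/-- The map `MSE_n(R, I) → MSE_n(R)`, `[(aᵢ)] ↦ [(aᵢ)]`. -/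
def MSERel.toMSE (n : ℕ) [NeZero n] (I : Ideal R) : MSERel n R I → MSE n R :=
  Quotient.map (fun v => ⟨v.1, v.2.1⟩) (by
    rintro ⟨v, hv⟩ ⟨w, hw⟩ ⟨g, hg, h⟩
    exact ⟨g, elementaryRel_le I hg, h⟩)

end NaturalMaps

section ExcisionRings

variable {R : Type*} [CommRing R] (I : Ideal R)

/-- The excision ring `ℤ ⊕ I`, with `(m, i)(k, j) = (mk, mj + ki + ij)`. -/
abbrev ZPlus : Type _ := Unitization ℤ I

/-- The excision ring `R ⊕ I`, with `(r, i)(s, j) = (rs, rj + si + ij)`. -/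
abbrev RPlus : Type _ := Unitization R I

/-- The ideal `0 ⊕ I` of `ℤ ⊕ I`. -/
def zIdeal : Ideal (ZPlus I) := RingHom.ker (Unitization.fstHom ℤ I)

/-- The ideal `0 ⊕ I` of `R ⊕ I`. -/
def rIdeal : Ideal (RPlus I) := RingHom.ker (Unitization.fstHom R I)

/-- `f : ℤ ⊕ I → R`, `f(m, i) = m + i`. -/
def zHom : ZPlus I →+* R where
  toFun x := (x.fst : R) + (x.snd : R)
  map_one' := by simp
  map_zero' := by simp
  map_add' x y := by simp; ring
  map_mul' x y := by simp; ring

/-- `π₂ : R ⊕ I → R`, `π₂(a, i) = a + i`. -/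
def rHom : RPlus I →+* R where
  toFun x := x.fst + (x.snd : R)
  map_one' := by simp
  map_zero' := by simp
  map_add' x y := by simp; ring
  map_mul' x y := by simp; ring

/-- `φ : ℤ ⊕ (0 ⊕ I) → ℤ ⊕ I`, `φ(m, (0, i)) = (m, i)`, where `0 ⊕ I` is an ideal of `R ⊕ I`. -/
def phi : ZPlus (rIdeal I) →+* ZPlus I where
  toFun x := Unitization.inl x.fst + Unitization.inr ((x.snd : RPlus I).snd)
  map_one' := by ext <;> simp
  map_zero' := by ext <;> simp
  map_add' x y := by ext <;> simp
  map_mul' x y := by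
    have hx : (x.snd : RPlus I).fst = 0 := x.snd.2
    have hy : (y.snd : RPlus I).fst = 0 := y.snd.2
    have hk (k : ℤ) : (k : RPlus I) = Unitization.inl (k : R) :=
      (map_intCast (Unitization.inlRingHom R I) k).symm
    ext <;> simp [hx, hy, hk]

theorem zIdeal_le : zIdeal I ≤ I.comap (zHom I) := by
  intro x hx
  have hx : x.fst = 0 := hx
  simp [zHom, hx]

theorem rIdeal_le : rIdeal I ≤ I.comap (rHom I) := by
  intro x hx
  have hx : x.fst = 0 := hx
  simp [rHom, hx]

variable (n : ℕ) [NeZero n]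

/-- `F : MSE_n(ℤ ⊕ I, 0 ⊕ I) → MSE_n(R, I)`, induced by `f`. -/
def mapF : MSERel n (ZPlus I) (zIdeal I) → MSERel n R I :=
  MSERel.map n (zHom I) (zIdeal_le I)

/-- `G : MSE_n(ℤ ⊕ I, 0 ⊕ I) → MSE_n(ℤ ⊕ I)`. -/
def mapG : MSERel n (ZPlus I) (zIdeal I) → MSE n (ZPlus I) :=
  MSERel.toMSE n (zIdeal I)

/-- `MSE_n(ℤ ⊕ (0 ⊕ I)) → MSE_n(ℤ ⊕ I)`, induced by `φ`. -/
def mapPhi : MSE n (ZPlus (rIdeal I)) → MSE n (ZPlus I) :=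
  MSE.map n (phi I)

/-- `π₂ : MSE_n(R ⊕ I, 0 ⊕ I) → MSE_n(R, I)`. -/
def mapPi₂ : MSERel n (RPlus I) (rIdeal I) → MSERel n R I :=
  MSERel.map n (rHom I) (rIdeal_le I)

end ExcisionRings

section Vv

variable {n : ℕ} [NeZero n] {R : Type*} [CommRing R]

/-- The row `(a(b + p) - 1, a₂(b + p), a₃, …, aₙ)` for `v = (a, a₂, …, aₙ)`. -/
def vvRow (v : Fin n → R) (b p : R) : Fin n → R := fun i =>
  if i = 0 then v 0 * (b + p) - 1 else if i = 1 then v 1 * (b + p) else v i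

/-- An operation on `MSE_n(R)` follows the Vaserstein–van der Kallen rule: for
`v = (a, a₂, …, aₙ)` and `w = (b, a₂, …, aₙ)` in `Um_n(R)` and `p` with
`a p ≡ 1 mod (a₂, …, aₙ)`, one has `[w] * [v] = [(a(b + p) - 1, a₂(b + p), a₃, …, aₙ)]`. -/
def FollowsVv (op : MSE n R → MSE n R → MSE n R) : Prop :=
  ∀ v w : Um n R, (∀ i, i ≠ 0 → w.1 i = v.1 i) →
    ∀ p : R, v.1 0 * p - 1 ∈ Ideal.span (v.1 '' {i | i ≠ 0}) →
      ∃ h : vvRow v.1 (w.1 0) p ∈ Um n R, op (MSE.mk w) (MSE.mk v) = MSE.mk ⟨_, h⟩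

/-- `op'` is the operation on `MSE_n(ℤ ⊕ I)` induced by the operation `op` on `MSE_n(R, I)`
through `F` and `G`. -/
def IsInduced (I : Ideal R) (op : MSERel n R I → MSERel n R I → MSERel n R I)
    (op' : MSE n (ZPlus I) → MSE n (ZPlus I) → MSE n (ZPlus I)) : Prop :=
  ∀ x y z : MSERel n (ZPlus I) (zIdeal I),
    mapF I n z = op (mapF I n x) (mapF I n y) →
      op' (mapG I n x) (mapG I n y) = mapG I n z

/-- An operation on `MSE_n(R, I)` follows the Vaserstein–van der Kallen rule if the induced
operation on `MSE_n(ℤ ⊕ I)` does. -/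
def FollowsVvRel (I : Ideal R) (op : MSERel n R I → MSERel n R I → MSERel n R I) : Prop :=
  ∃ op', IsInduced I op op' ∧ FollowsVv op'

/-- Two classes in `MSE_n(R)` can be written as `[(b, a₂, …, aₙ)]` and `[(a, a₂, …, aₙ)]`, so
that the Vaserstein–van der Kallen rule gives their product. -/
def CommonTail (x y : MSE n R) : Prop :=
  ∃ v w : Um n R, MSE.mk w = x ∧ MSE.mk v = y ∧ ∀ i, i ≠ 0 → w.1 i = v.1 i

/-- Two classes in `MSE_n(R, I)` correspond, under `F` and `G`, to classes in `MSE_n(ℤ ⊕ I)`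
whose product is given by the Vaserstein–van der Kallen rule. -/
def CommonTailRel (I : Ideal R) (x y : MSERel n R I) : Prop :=
  ∃ x' y' : MSERel n (ZPlus I) (zIdeal I), mapF I n x' = x ∧ mapF I n y' = y ∧
    CommonTail (mapG I n x') (mapG I n y')

/-- An operation on `MSE_n(R, I)` is nice:
`[(b, a₂, …, aₙ)] * [(a, a₂, …, aₙ)] = [(ab, a₂, …, aₙ)]` for rows in `Um_n(R, I)`. -/
def IsNiceRel (I : Ideal R) (op : MSERel n R I → MSERel n R I → MSERel n R I) : Prop :=
  ∀ v w : UmRel n R I, (∀ i, i ≠ 0 → w.1 i = v.1 i) →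
    ∃ h : Function.update v.1 0 (v.1 0 * w.1 0) ∈ UmRel n R I,
      op (MSERel.mk w) (MSERel.mk v) = MSERel.mk ⟨_, h⟩

end Vv

end Excision

end

/-!
Let `φ : A → R` map the ideal `J` bijectively onto the ideal `I`. Rows congruent to `e₁` modulo `I`
then lift uniquely to rows over `A` congruent to `e₁` modulo `J`. Conjugates of `E₂₁(x)`, `x ∈ I`,
have the form `1 + cᵗ(xr)` with `r` orthogonal to the unimodular `c`; splitting `r` into Koszul rows
factors them into matrices `E_{ij}(a)` with `a ∈ I` whenever `i` is the first index. Applying such a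
matrix to a row congruent to `e₁` changes one entry by an element of `I`, and a Mennicke-type
computation shows that the same change over `A` does not leave the `E_n(A)`-orbit. So rows over `A`
whose images are `E_n(R, I)`-equivalent are `E_n(A)`-equivalent.

If `J` is the kernel of a retraction of `A` onto a Euclidean domain `B`, as for `ℤ ⊕ I → ℤ`, the
elements of `E_n(B)` fixing `e₁` are products of elementary matrices fixing `e₁`. These lift to
`E_n(A)` with any prescribed row congruent to `e₁` as a fixed row. Hence `E_n(A)`- and
`E_n(A, J)`-equivalence agree on such rows, which gives the bijectivity of `F` and `G`; the other
bijections follow by two-out-of-three. The Vaserstein–van der Kallen rule is preserved by ring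
homomorphisms, and `φ` induces a ring homomorphism `ℤ ⊕ J → ℤ ⊕ I` compatible with `F` and `G`.
-/

noncomputable section

namespace Excision

open Matrix

section Dyads

variable {m R : Type*} [DecidableEq m] [CommRing R]

theorem one_add_vecMulVec_single_single (i j : m) (a b : R) :
    1 + vecMulVec (Pi.single i a) (Pi.single j b) = transvection i j (a * b) := by
  ext k l
  by_cases hk : i = k <;> by_cases hl : j = l <;>
    simp [transvection, vecMulVec_apply, eq_comm, hk, hl]

variable [Fintype m]

/-- The elementary matrix `E_{ij}(c)`, `i ≠ j`, as an element of `GL_m(R)`. -/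
def glTransvection {i j : m} (hij : i ≠ j) (c : R) : GL m R :=
  SpecialLinearGroup.toGL (.transvection hij c)

@[simp]
theorem coe_glTransvection {i j : m} (hij : i ≠ j) (c : R) :
    (glTransvection hij c : Matrix m m R) = transvection i j c :=
  rfl

theorem inv_glTransvection {i j : m} (hij : i ≠ j) (c : R) :
    (glTransvection hij c)⁻¹ = glTransvection hij (-c) := by
  rw [glTransvection, ← map_inv, SpecialLinearGroup.transvection_inv, glTransvection]

/-- The matrices underlying the elements of a subgroup of `GL_m(R)`; a submonoid because membership
of a product can then be checked on factors that are only known as matrices. -/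
def matrices (T : Subgroup (GL m R)) : Submonoid (Matrix m m R) :=
  T.toSubmonoid.map (Units.coeHom _)

theorem dotProduct_inv_mulVec (v w : m → R) (g : GL m R) :
    (v ᵥ* (g : Matrix m m R)) ⬝ᵥ ((g⁻¹ : GL m R).val *ᵥ w) = v ⬝ᵥ w := by
  rw [dotProduct_mulVec, vecMul_vecMul, Units.mul_inv, vecMul_one]

theorem vecMul_one_add_vecMulVec (v s z : m → R) :
    v ᵥ* (1 + vecMulVec s z) = v + (v ⬝ᵥ s) • z := by
  rw [vecMul_add, vecMul_one, vecMul_vecMulVec]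

theorem one_add_vecMulVec_mul_same_left {s z : m → R} (z' : m → R) (h : z ⬝ᵥ s = 0) :
    (1 + vecMulVec s z) * (1 + vecMulVec s z') = 1 + vecMulVec s (z + z') := by
  rw [mul_one_add, add_mul, vecMulVec_mul_vecMulVec, h, vecMulVec_add, zero_smul, vecMulVec_zero,
    one_mul, add_zero, add_assoc]

theorem one_add_vecMulVec_mul_same_right (s : m → R) {s' z : m → R} (h : z ⬝ᵥ s' = 0) :
    (1 + vecMulVec s z) * (1 + vecMulVec s' z) = 1 + vecMulVec (s + s') z := by
  rw [mul_one_add, add_mul, vecMulVec_mul_vecMulVec, h, add_vecMulVec, zero_smul, vecMulVec_zero,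
    one_mul, add_zero, add_assoc]

variable {M : Submonoid (Matrix m m R)} {ι : Type*} {t : Finset ι}

theorem one_add_vecMulVec_sum_right_mem {s : m → R} {z : ι → m → R} (h0 : ∀ a ∈ t, z a ⬝ᵥ s = 0)
    (h : ∀ a ∈ t, 1 + vecMulVec s (z a) ∈ M) : 1 + vecMulVec s (∑ a ∈ t, z a) ∈ M := by
  refine (Finset.sum_induction z (fun y => y ⬝ᵥ s = 0 ∧ 1 + vecMulVec s y ∈ M) ?_ (by simp)
    fun a ha => ⟨h0 a ha, h a ha⟩).2
  rintro y y' ⟨hy, hyM⟩ ⟨hy', hyM'⟩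
  refine ⟨by rw [add_dotProduct, hy, hy', add_zero], ?_⟩
  rw [← one_add_vecMulVec_mul_same_left y' hy]
  exact M.mul_mem hyM hyM'

theorem one_add_vecMulVec_sum_left_mem {s : ι → m → R} {z : m → R} (h0 : ∀ a ∈ t, z ⬝ᵥ s a = 0)
    (h : ∀ a ∈ t, 1 + vecMulVec (s a) z ∈ M) : 1 + vecMulVec (∑ a ∈ t, s a) z ∈ M := by
  refine (Finset.sum_induction s (fun y => z ⬝ᵥ y = 0 ∧ 1 + vecMulVec y z ∈ M) ?_ (by simp)
    fun a ha => ⟨h0 a ha, h a ha⟩).2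
  rintro y y' ⟨hy, hyM⟩ ⟨hy', hyM'⟩
  refine ⟨by rw [dotProduct_add, hy, hy', add_zero], ?_⟩
  rw [← one_add_vecMulVec_mul_same_right y hy']
  exact M.mul_mem hyM hyM'

theorem vecMul_transvection (v : m → R) (i j : m) (c : R) :
    v ᵥ* transvection i j c = v + Pi.single j (v i * c) := by
  rw [← one_mul c, ← one_add_vecMulVec_single_single, vecMul_one_add_vecMulVec,
    dotProduct_single_one, ← Pi.single_smul, one_mul, smul_eq_mul]

theorem one_add_vecMulVec_mem_of_disjoint {s z : m → R} (h0 : ∀ i, s i = 0 ∨ z i = 0)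
    (h : ∀ i j, i ≠ j → transvection i j (s i * z j) ∈ M) : 1 + vecMulVec s z ∈ M := by
  have hzs : ∀ i, z i * s i = 0 := fun i => (h0 i).elim (by simp [·]) (by simp [·])
  have hcol : ∀ i, 1 + vecMulVec (Pi.single i (s i)) z ∈ M := fun i => by
    rw [← Finset.univ_sum_single z]
    refine one_add_vecMulVec_sum_right_mem (fun j _ => ?_) fun j _ => ?_
    · obtain rfl | hij := eq_or_ne i j <;> simp [*]
    · obtain rfl | hij := eq_or_ne i j
      · rw [one_add_vecMulVec_single_single, mul_comm, hzs, transvection_zero]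
        exact M.one_mem
      · exact one_add_vecMulVec_single_single i j (s i) (z j) ▸ h i j hij
  rw [← Finset.univ_sum_single s]
  exact one_add_vecMulVec_sum_left_mem (fun i _ => by simp [hzs]) fun i _ => hcol i

-- The dyad is the commutator of `1 + sᵗ e_k` and `1 + e_kᵗ z`.
theorem one_add_vecMulVec_mem_of_orthogonal {s z : m → R} {k : m} (hs : s k = 0) (hz : z k = 0)
    (hzs : z ⬝ᵥ s = 0) (hsM : ∀ i, i ≠ k → ∀ c, transvection i k (s i * c) ∈ M)
    (hzM : ∀ j, k ≠ j → ∀ c, transvection k j (c * z j) ∈ M) : 1 + vecMulVec s z ∈ M := by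
  have hcol : ∀ c, 1 + vecMulVec s (Pi.single k c) ∈ M := fun c =>
    one_add_vecMulVec_mem_of_disjoint
      (fun i => (eq_or_ne i k).imp (by rintro rfl; exact hs) (by simp [·]))
      fun i j hij => by obtain rfl | hj := eq_or_ne j k <;> simp [*, M.one_mem]
  have hrow : ∀ c, 1 + vecMulVec (Pi.single k c) z ∈ M := fun c =>
    one_add_vecMulVec_mem_of_disjoint
      (fun i => (eq_or_ne i k).symm.imp (by simp [·]) (by rintro rfl; exact hz))
      fun i j hij => by obtain rfl | hi := eq_or_ne i k <;> simp [*, M.one_mem]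
  have hcomm : 1 + vecMulVec s z =
      (1 + vecMulVec s (Pi.single k 1)) * (1 + vecMulVec (Pi.single k 1) z) *
      ((1 + vecMulVec s (Pi.single k (-1))) * (1 + vecMulVec (Pi.single k (-1)) z)) := by
    simp only [add_mul, mul_add, vecMulVec_mul_vecMulVec, one_mul, mul_one]
    simp [hs, hz, hzs, Pi.single_neg]
    abel
  rw [hcomm]
  exact M.mul_mem (M.mul_mem (hcol 1) (hrow 1)) (M.mul_mem (hcol (-1)) (hrow (-1)))

end Dyads

section RowEquivalence

variable {n : ℕ} {A : Type*} [CommRing A]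

theorem glTransvection_mem_elementary {i j : Fin n} (hij : i ≠ j) (c : A) :
    glTransvection hij c ∈ elementary n A :=
  Subgroup.subset_closure ⟨i, j, hij, c, rfl⟩

/-- Two rows lie in the same orbit of `E_n(A)`; unlike in `MSE n A`, they need not be unimodular. -/
def RowEquiv (v w : Fin n → A) : Prop :=
  ∃ g ∈ elementary n A, v ᵥ* (g : Matrix (Fin n) (Fin n) A) = w

theorem RowEquiv.refl (v : Fin n → A) : RowEquiv v v :=
  (orbitSetoid Set.univ (elementary n A)).refl ⟨v, trivial⟩

theorem RowEquiv.symm {v w : Fin n → A} (h : RowEquiv v w) : RowEquiv w v :=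
  (orbitSetoid Set.univ (elementary n A)).symm (a := ⟨v, trivial⟩) (b := ⟨w, trivial⟩) h

theorem RowEquiv.trans {u v w : Fin n → A} (h : RowEquiv u v) (h' : RowEquiv v w) :
    RowEquiv u w :=
  (orbitSetoid Set.univ (elementary n A)).trans (a := ⟨u, trivial⟩) (b := ⟨v, trivial⟩)
    (c := ⟨w, trivial⟩) h h'

theorem IsUnimodular.vecMul {v : Fin n → A} (hv : IsUnimodular v) (g : GL (Fin n) A) :
    IsUnimodular (v ᵥ* (g : Matrix (Fin n) (Fin n) A)) := by
  obtain ⟨w, hw⟩ := hv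
  exact ⟨(g⁻¹ : GL (Fin n) A).val *ᵥ w, by rw [dotProduct_inv_mulVec, hw]⟩

theorem RowEquiv.add_single_dotProduct (v : Fin n → A) {c : Fin n → A} {j : Fin n} (hc : c j = 0) :
    RowEquiv v (v + Pi.single j (v ⬝ᵥ c)) := by
  have hdisj : ∀ i, c i = 0 ∨ (Pi.single j 1 : Fin n → A) i = 0 := fun i =>
    (eq_or_ne i j).imp (by rintro rfl; exact hc) (by simp [·])
  obtain ⟨g, hg, hgc⟩ := one_add_vecMulVec_mem_of_disjoint (M := matrices (elementary n A)) hdisj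
    fun i k hik => ⟨_, glTransvection_mem_elementary hik _, rfl⟩
  refine ⟨g, hg, ?_⟩
  rw [show (g : Matrix (Fin n) (Fin n) A) = _ from hgc, vecMul_one_add_vecMulVec, ← Pi.single_smul,
    smul_eq_mul, mul_one]

theorem RowEquiv.add_single_mul_add_mul (v : Fin n → A) {i j k : Fin n} (hij : i ≠ j) (hkj : k ≠ j)
    (c d : A) : RowEquiv v (v + Pi.single j (v i * c + v k * d)) := by
  rw [← dotProduct_single, ← dotProduct_single, ← dotProduct_add]
  exact RowEquiv.add_single_dotProduct v (by simp [hij.symm, hkj.symm])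

theorem RowEquiv.add_single_mul_transfer (u : Fin n → A) {i j k : Fin n} (hij : i ≠ j) (hik : i ≠ k)
    (hjk : j ≠ k) {r s : A} (h : u i ∣ (1 + r) * s - 1) :
    RowEquiv (u + Pi.single j (r * u j)) (u + Pi.single k (r * u k)) := by
  obtain ⟨m, hm⟩ := h
  let row (p q : A) : Fin n → A := u + Pi.single j p + Pi.single k q
  have add_j : ∀ p q c, RowEquiv (row p q) (row (p + (u k + q) * c) q) := fun p q c => by
    have := RowEquiv.add_single_mul_add_mul (row p q) hjk.symm hjk.symm c 0
    simpa [row, hjk.symm, Pi.single_add, add_comm, add_left_comm] using this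
  have add_k : ∀ p q c d, RowEquiv (row p q) (row p (q + ((u j + p) * c + u i * d))) :=
    fun p q c d => by
      have := RowEquiv.add_single_mul_add_mul (row p q) hjk hik c d
      simpa [row, hij, hik, hjk, Pi.single_add, add_assoc] using this
  set x := u j
  set y := u k
  have h₁ := add_j (r * x) 0 (-r * (1 + r))
  have h₂ := add_k (r * x + (y + 0) * (-r * (1 + r))) 0 (-s) (m * (x - r * y))
  have h₃ := add_j (r * x + (y + 0) * (-r * (1 + r))) (r * y - x) r
  have h₄ := add_k 0 (r * y - x) 1 0
  rw [show 0 + ((x + (r * x + (y + 0) * (-r * (1 + r)))) * -s + u i * (m * (x - r * y))) =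
    r * y - x by linear_combination (-(x - r * y)) * hm] at h₂
  rw [show r * x + (y + 0) * (-r * (1 + r)) + (y + (r * y - x)) * r = 0 by ring] at h₃
  rw [show r * y - x + ((x + 0) * 1 + u i * 0) = r * y by ring] at h₄
  simpa [row] using ((h₁.trans h₂).trans h₃).trans h₄

theorem RowEquiv.add_single_of_dvd_sq {u w : Fin n → A} (hw : u ⬝ᵥ w = 1) {i j k : Fin n}
    (hij : i ≠ j) (hik : i ≠ k) (hjk : j ≠ k) {b : A} (hsq : u i ∣ (b * w j) ^ 2)
    (hk : u i ∣ b * w j * u k) : RowEquiv u (u + Pi.single j b) := by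
  have scale_k : RowEquiv u (u + Pi.single k (b * w j * u k)) := by
    obtain ⟨c, hc⟩ := hk
    simpa [hc] using RowEquiv.add_single_mul_add_mul u hik hik c 0
  have scale_j : RowEquiv (u + Pi.single k (b * w j * u k)) (u + Pi.single j (b * w j * u j)) :=
    (RowEquiv.add_single_mul_transfer u hij hik hjk (s := 1 - b * w j)
      (by convert hsq.neg_right using 1; ring)).symm
  have add_b : RowEquiv (u + Pi.single j (b * w j * u j)) (u + Pi.single j b) := by
    have hdot : (u + Pi.single j (b * w j * u j)) ⬝ᵥ (b • w - Pi.single j (b * w j)) =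
        b - b * w j * u j := by
      simp only [add_dotProduct, dotProduct_sub, dotProduct_smul, dotProduct_single,
        single_dotProduct, hw, Pi.add_apply, Pi.single_eq_same, smul_eq_mul]
      ring
    convert RowEquiv.add_single_dotProduct (u + Pi.single j (b * w j * u j))
      (c := b • w - Pi.single j (b * w j)) (j := j) (by simp) using 1
    rw [hdot, add_assoc, ← Pi.single_add, add_sub_cancel]
  exact (scale_k.trans scale_j).trans add_b

end RowEquivalence

section Suslin

variable {m R : Type*} [DecidableEq m] [CommRing R]

/-- The row `c_i e_j - c_j e_i`. These rows generate all rows orthogonal to `c` when `c` is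
unimodular, by exactness of the Koszul complex. -/
def koszulRow (c : m → R) (i j : m) : m → R :=
  Pi.single j (c i) - Pi.single i (c j)

variable [Fintype m]

theorem eq_sum_koszulRow {c d r : m → R} (hd : d ⬝ᵥ c = 1) (hr : r ⬝ᵥ c = 0) :
    r = ∑ p : m × m, (d p.1 * r p.2) • koszulRow c p.1 p.2 := by
  ext l
  have hl : ∀ i j, (d i * r j) • koszulRow c i j l =
      d i * c i * (Pi.single j (r j) : m → R) l -
      r j * c j * (Pi.single i (d i) : m → R) l := fun i j => by
    simp only [koszulRow, Pi.sub_apply, Pi.single_apply, smul_eq_mul]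
    split_ifs <;> ring
  simp only [Finset.sum_apply, Pi.smul_apply, Fintype.sum_prod_type, hl, Finset.sum_sub_distrib,
    ← Finset.mul_sum, ← Finset.sum_mul]
  change r l = d ⬝ᵥ c * _ - r ⬝ᵥ c * _
  simp [hd, hr]

/-- The monoid generated by the `E_{ij}(a)` with `i ≠ j`, where `a` is required to lie in `I` if
`i = o`. For `o = 0` it contains `E_n(R, I)`, and its generators act on `Um_n(R, I)` in a way that
can be lifted along an excision. -/
def mixedMonoid (o : m) (I : Ideal R) : Submonoid (Matrix m m R) :=
  Submonoid.closure {g | ∃ i j, i ≠ j ∧ ∃ a : R, (i = o → a ∈ I) ∧ g = transvection i j a}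

theorem transvection_mem_mixedMonoid {o i j : m} {I : Ideal R} {a : R} (hij : i ≠ j)
    (ha : i = o → a ∈ I) : transvection i j a ∈ mixedMonoid o I :=
  Submonoid.subset_closure ⟨i, j, hij, a, ha, rfl⟩

theorem one_add_vecMulVec_koszulRow_mem_mixedMonoid (o : m) {I : Ideal R} (c : m → R) {i j k : m}
    (hki : k ≠ i) (hkj : k ≠ j) {x : R} (hx : x ∈ I) :
    1 + vecMulVec c (x • koszulRow c i j) ∈ mixedMonoid o I := by
  obtain rfl | hij := eq_or_ne i j
  · simp [koszulRow, one_mem]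
  set z := koszulRow c i j
  set s : m → R := Pi.single i (c i) + Pi.single j (c j) with hs
  have hz : ∀ l, l ≠ i → l ≠ j → z l = 0 := fun l hi hj => by simp [z, koszulRow, hi, hj]
  have hzs : z ⬝ᵥ s = 0 := by
    simp [z, s, koszulRow, hij, hij.symm, mul_comm]
  have hcs : ∀ l, (c - s) l = 0 ∨ (x • z) l = 0 := fun l => by
    obtain rfl | hi := eq_or_ne l i
    · simp [s, hij]
    obtain rfl | hj := eq_or_ne l j
    · simp [s, hij.symm]
    exact .inr (by simp [hz l hi hj])
  have hxI : ∀ a b : R, a * (x * b) ∈ I := fun a b => I.mul_mem_left _ (I.mul_mem_right _ hx)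
  rw [← sub_add_cancel c s, ← one_add_vecMulVec_mul_same_right _ (by simp [hzs])]
  refine mul_mem (one_add_vecMulVec_mem_of_disjoint hcs fun a b hab =>
    transvection_mem_mixedMonoid hab fun _ => hxI _ _) ?_
  have hsk : s k = 0 := by simp [s, hki, hkj]
  obtain rfl | hk := eq_or_ne k o
  · exact one_add_vecMulVec_mem_of_orthogonal hsk (by simp [hz k hki hkj]) (by simp [hzs])
      (fun a ha _ => transvection_mem_mixedMonoid ha fun h => absurd h ha)
      fun b hb _ => transvection_mem_mixedMonoid hb fun _ => hxI _ _
  · rw [vecMulVec_smul, ← smul_vecMulVec]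
    exact one_add_vecMulVec_mem_of_orthogonal (by simp [hsk]) (hz k hki hkj) (by simp [hzs])
      (fun a ha _ => transvection_mem_mixedMonoid ha fun _ =>
        I.mul_mem_right _ (I.mul_mem_right _ hx))
      fun b hb _ => transvection_mem_mixedMonoid hb fun h => absurd h hk

variable {n : ℕ} {I : Ideal R}

theorem one_add_vecMulVec_smul_mem_mixedMonoid (hn : 2 < n) (o : Fin n) {c d r : Fin n → R}
    (hd : d ⬝ᵥ c = 1) (hr : r ⬝ᵥ c = 0) {x : R} (hx : x ∈ I) :
    1 + vecMulVec c (x • r) ∈ mixedMonoid o I := by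
  rw [eq_sum_koszulRow hd hr, Finset.smul_sum]
  refine one_add_vecMulVec_sum_right_mem (fun p _ => ?_) fun p _ => ?_
  · simp [koszulRow, sub_dotProduct, mul_comm]
  · obtain ⟨k, hki, hkj⟩ := Fin.exists_ne_and_ne_of_two_lt p.1 p.2 hn
    rw [smul_smul]
    exact one_add_vecMulVec_koszulRow_mem_mixedMonoid o c hki hkj (I.mul_mem_right _ hx)

theorem conj_transvection_mem_mixedMonoid (hn : 2 < n) (o : Fin n) {i j : Fin n} (hij : i ≠ j)
    {x : R} (hx : x ∈ I) (h : GL (Fin n) R) :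
    (h : Matrix (Fin n) (Fin n) R) * transvection i j x * (h⁻¹ : GL (Fin n) R).val ∈
      mixedMonoid o I := by
  have horth : ∀ k, (Pi.single k 1 ᵥ* (h⁻¹ : GL (Fin n) R).val) ⬝ᵥ (h.val *ᵥ Pi.single i 1) =
      (Pi.single k 1 : Fin n → R) i := fun k => by
    simpa using dotProduct_inv_mulVec (Pi.single k 1) (Pi.single i 1) h⁻¹
  convert one_add_vecMulVec_smul_mem_mixedMonoid hn o (by rw [horth, Pi.single_eq_same])
    (by rw [horth, Pi.single_eq_of_ne hij]) hx using 1
  rw [← one_mul x, ← one_add_vecMulVec_single_single i j 1 x, mul_add, add_mul, mul_vecMulVec,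
    vecMulVec_mul, one_mul, mul_one, Units.mul_inv, ← smul_vecMul, ← Pi.single_smul, smul_eq_mul,
    mul_one]

variable [NeZero n]

theorem coe_mem_mixedMonoid_of_mem_elementaryRel (hn : 2 < n) {g : GL (Fin n) R}
    (hg : g ∈ elementaryRel n R I) : (g : Matrix (Fin n) (Fin n) R) ∈ mixedMonoid 0 I := by
  have h10 : (1 : Fin n) ≠ 0 := by simp; omega
  obtain ⟨g, hg, rfl⟩ := hg
  induction hg using Subgroup.closure_induction'' with
  | one => exact one_mem _
  | mul a b _ _ ha hb => simpa using mul_mem ha hb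
  | mem g hg =>
    obtain ⟨t, ⟨x, hx, ht⟩, hc⟩ := Group.mem_conjugatesOfSet_iff.1 hg
    obtain ⟨h, rfl⟩ := isConj_iff.1 hc
    simpa [ht] using conj_transvection_mem_mixedMonoid hn 0 h10 hx h
  | inv_mem g hg =>
    obtain ⟨t, ⟨x, hx, ht⟩, hc⟩ := Group.mem_conjugatesOfSet_iff.1 hg
    obtain ⟨h, rfl⟩ := isConj_iff.1 hc
    have ht' : (t : GL (Fin n) R) = glTransvection h10 x := Units.ext ht
    simpa [ht', inv_glTransvection, mul_assoc] using
      conj_transvection_mem_mixedMonoid hn 0 h10 (I.neg_mem hx) h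

end Suslin

section Lifting

variable {n : ℕ} [NeZero n] {A R : Type*} [CommRing A] [CommRing R]

/-- The row `v` is congruent to `e₁ = (1, 0, …, 0)` modulo `I`; unlike an element of `UmRel n R I`,
it need not be unimodular. -/
def IsBasedRow (I : Ideal R) (v : Fin n → R) : Prop :=
  ∀ i, v i - (Pi.single 0 1 : Fin n → R) i ∈ I

theorem mem_umRel_iff {I : Ideal R} {v : Fin n → R} :
    v ∈ UmRel n R I ↔ IsUnimodular v ∧ IsBasedRow I v := by
  refine and_congr_right fun _ => ⟨fun h i => ?_, fun h => ⟨?_, fun i hi => ?_⟩⟩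
  · obtain rfl | hi := eq_or_ne i 0
    · simpa using h.1
    · simpa [hi] using h.2 i hi
  · simpa using h 0
  · simpa [hi] using h i

theorem IsBasedRow.apply_mem {I : Ideal R} {v : Fin n → R} (hv : IsBasedRow I v) {i : Fin n}
    (hi : i ≠ 0) : v i ∈ I := by
  simpa [hi] using hv i

theorem IsBasedRow.add_single {I : Ideal R} {v : Fin n → R} (hv : IsBasedRow I v) (j : Fin n)
    {b : R} (hb : b ∈ I) : IsBasedRow I (v + Pi.single j b) := fun i => by
  rw [Pi.add_apply, add_sub_right_comm]
  refine I.add_mem (hv i) ?_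
  obtain rfl | hij := eq_or_ne i j <;> simp [*]

theorem IsBasedRow.dotProduct_sub_mem {I : Ideal R} {v : Fin n → R} (hv : IsBasedRow I v)
    (w : Fin n → R) : v ⬝ᵥ w - w 0 ∈ I := by
  have h : v ⬝ᵥ w - w 0 = (v - Pi.single 0 1) ⬝ᵥ w := by
    rw [sub_dotProduct, single_dotProduct, one_mul]
  rw [h]
  exact I.sum_mem fun i _ => I.mul_mem_right _ (hv i)

theorem exists_isBasedRow_dotProduct_eq_one {I : Ideal R} {v : Fin n → R} (hv : v ∈ UmRel n R I) :
    ∃ w, v ⬝ᵥ w = 1 ∧ IsBasedRow I w := by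
  obtain ⟨⟨w, hw⟩, hv⟩ := mem_umRel_iff.1 hv
  have hw0 : 1 - w 0 ∈ I := hw ▸ hv.dotProduct_sub_mem w
  have hq : 1 - v 0 * w 0 ∈ I := by
    have hv0 : v 0 - 1 ∈ I := by simpa using hv 0
    convert I.sub_mem hw0 (I.mul_mem_right (w 0) hv0) using 1
    ring
  refine ⟨(1 - v 0 * w 0) • w + Pi.single 0 (w 0), ?_, fun i => ?_⟩
  · rw [dotProduct_add, dotProduct_smul, hw, dotProduct_single, smul_eq_mul]
    ring
  · have hi : (Pi.single 0 (w 0 - 1) : Fin n → R) i ∈ I := by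
      obtain rfl | hi := eq_or_ne i 0
      · simpa using I.neg_mem hw0
      · simp [hi]
    simpa [Pi.single_sub, add_sub_assoc] using I.add_mem (I.mul_mem_right (w i) hq) hi

variable {φ : A →+* R} {J : Ideal A} {I : Ideal R}

theorem eq_of_bijOn (h : Set.BijOn φ J I) {x y : A} (hxy : x - y ∈ J) (e : φ x = φ y) : x = y :=
  sub_eq_zero.1 (h.injOn hxy J.zero_mem (by simp [e]))

theorem dvd_of_bijOn (h : Set.BijOn φ J I) {u x : A} (hx : x ∈ J) {z : R} (hz : z ∈ I)
    (e : φ x = φ u * z) : u ∣ x := by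
  obtain ⟨y, hy, rfl⟩ := h.surjOn hz
  exact ⟨y, eq_of_bijOn h (J.sub_mem hx (J.mul_mem_left _ hy)) (by rw [e, map_mul])⟩

theorem IsBasedRow.exists_lift (h : Set.BijOn φ J I) {v : Fin n → R} (hv : IsBasedRow I v) :
    ∃ u, IsBasedRow J u ∧ φ ∘ u = v := by
  choose x hx e using fun i => h.surjOn (hv i)
  refine ⟨Pi.single 0 1 + x, fun i => by simpa using hx i, funext fun i => ?_⟩
  obtain rfl | hi := eq_or_ne i 0 <;> simp [*]

theorem IsBasedRow.eq_of_comp_eq (h : Set.BijOn φ J I) {u v : Fin n → A} (hu : IsBasedRow J u)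
    (hv : IsBasedRow J v) (e : φ ∘ u = φ ∘ v) : u = v :=
  funext fun i => eq_of_bijOn h (by simpa using J.sub_mem (hu i) (hv i)) (congrFun e i)

theorem exists_umRel_lift (h : Set.BijOn φ J I) {v : Fin n → R} (hv : v ∈ UmRel n R I) :
    ∃ u ∈ UmRel n A J, φ ∘ u = v := by
  obtain ⟨w, hvw, hw⟩ := exists_isBasedRow_dotProduct_eq_one hv
  obtain ⟨u, hu, rfl⟩ := (mem_umRel_iff.1 hv).2.exists_lift h
  obtain ⟨w, hwJ, rfl⟩ := hw.exists_lift h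
  refine ⟨u, mem_umRel_iff.2 ⟨⟨w, eq_of_bijOn h ?_ ?_⟩, hu⟩, rfl⟩
  · simpa using J.add_mem (hu.dotProduct_sub_mem w) (hwJ 0)
  · rw [RingHom.map_dotProduct, hvw, map_one]

theorem exists_rowEquiv_add_single (h : Set.BijOn φ J I) (hn : 2 < n) {v : Fin n → A}
    (hv : v ∈ UmRel n A J) {i j : Fin n} (hij : i ≠ j) {a : R} (ha : i = 0 → a ∈ I) :
    ∃ b ∈ J, φ b = φ (v i) * a ∧ RowEquiv v (v + Pi.single j b) := by
  obtain rfl | hi := eq_or_ne i 0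
  · obtain ⟨y, hy, rfl⟩ := h.surjOn (ha rfl)
    refine ⟨v 0 * y, J.mul_mem_left _ hy, map_mul _ _ _, ?_⟩
    simpa using RowEquiv.add_single_mul_add_mul v hij hij y 0
  obtain ⟨w, hvw, hw⟩ := exists_isBasedRow_dotProduct_eq_one hv
  obtain ⟨k, hki, hkj⟩ := Fin.exists_ne_and_ne_of_two_lt i j hn
  have hv := (mem_umRel_iff.1 hv).2
  have hφi : ∀ r, φ (v i) * r ∈ I := fun r => I.mul_mem_right _ (h.mapsTo (hv.apply_mem hi))
  have hwv : w j * v k ∈ J := by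
    obtain rfl | hj := eq_or_ne j 0
    · exact J.mul_mem_left _ (hv.apply_mem hkj)
    · exact J.mul_mem_right _ (hw.apply_mem hj)
  obtain ⟨b, hb, eb⟩ := h.surjOn (hφi a)
  refine ⟨b, hb, eb, RowEquiv.add_single_of_dvd_sq hvw hij hki.symm hkj.symm
    (dvd_of_bijOn h (J.pow_mem_of_mem (J.mul_mem_right _ hb) 2 two_pos)
      (hφi ((a * φ (w j)) ^ 2)) ?_)
    (dvd_of_bijOn h (J.mul_mem_right _ (J.mul_mem_right _ hb))
      (I.mul_mem_right a (h.mapsTo hwv)) ?_)⟩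
  · rw [map_pow, map_mul, eb]
    ring
  · rw [map_mul, map_mul, eb, map_mul]
    ring

theorem exists_rowEquiv_lift (h : Set.BijOn φ J I) (hn : 2 < n) {M : Matrix (Fin n) (Fin n) R}
    (hM : M ∈ mixedMonoid 0 I) {v : Fin n → A} (hv : v ∈ UmRel n A J) :
    ∃ w ∈ UmRel n A J, φ ∘ w = (φ ∘ v) ᵥ* M ∧ RowEquiv v w := by
  induction hM using Submonoid.closure_induction generalizing v with
  | one => exact ⟨v, hv, (vecMul_one _).symm, .refl v⟩
  | mul M N _ _ ihM ihN =>
    obtain ⟨w, hw, e, hvw⟩ := ihM hv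
    obtain ⟨x, hx, e', hwx⟩ := ihN hw
    exact ⟨x, hx, by rw [e', e, vecMul_vecMul], hvw.trans hwx⟩
  | mem M hM =>
    obtain ⟨i, j, hij, a, ha, rfl⟩ := hM
    obtain ⟨b, hb, e, g, hg, hgv⟩ := exists_rowEquiv_add_single h hn hv hij ha
    obtain ⟨hvU, hvJ⟩ := mem_umRel_iff.1 hv
    refine ⟨_, mem_umRel_iff.2 ⟨hgv ▸ hvU.vecMul g, hvJ.add_single j hb⟩, ?_, g, hg, hgv⟩
    rw [vecMul_transvection]
    ext k
    obtain rfl | hk := eq_or_ne k j <;> simp [*]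

theorem rowEquiv_of_comp_vecMul_eq (h : Set.BijOn φ J I) (hn : 2 < n) {v w : Fin n → A}
    (hv : v ∈ UmRel n A J) (hw : w ∈ UmRel n A J) {g : GL (Fin n) R}
    (hg : g ∈ elementaryRel n R I) (e : (φ ∘ v) ᵥ* (g : Matrix (Fin n) (Fin n) R) = φ ∘ w) :
    RowEquiv v w := by
  obtain ⟨x, hx, ex, hvx⟩ :=
    exists_rowEquiv_lift h hn (coe_mem_mixedMonoid_of_mem_elementaryRel hn hg) hv
  rwa [← (mem_umRel_iff.1 hx).2.eq_of_comp_eq h (mem_umRel_iff.1 hw).2 (ex.trans e)]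

end Lifting

section EuclideanDomains

variable {m R : Type*} [DecidableEq m] [Fintype m]

section Subgroups

variable [CommRing R]

/-- The subgroup of `GL_m(R)` fixing the row `v` under right multiplication. -/
def rowStabilizer (v : m → R) : Subgroup (GL m R) where
  carrier := {g | v ᵥ* (g : Matrix m m R) = v}
  one_mem' := by simp
  mul_mem' := fun {a b} ha hb => by
    simp only [Set.mem_ofPred_eq] at *
    rw [Units.val_mul, ← vecMul_vecMul, ha, hb]
  inv_mem' := fun {a} ha => by
    simp only [Set.mem_ofPred_eq] at *
    rw [← congrArg (· ᵥ* _) ha, vecMul_vecMul, Units.mul_inv, vecMul_one]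

theorem mem_rowStabilizer {v : m → R} {g : GL m R} :
    g ∈ rowStabilizer v ↔ v ᵥ* (g : Matrix m m R) = v :=
  Iff.rfl

theorem eq_one_of_forall_mem_rowStabilizer {g : GL m R}
    (hg : ∀ a, g ∈ rowStabilizer (Pi.single a 1)) : g = 1 :=
  Units.ext <| ext_of_single_vecMul fun a => by rw [mem_rowStabilizer.1 (hg a), Units.val_one,
    vecMul_one]

/-- The group generated by the `E_{ij}(c)` with `i ∈ S` and `j ≠ i`. It consists of matrices that
agree with the identity in the rows outside `S`. -/
def elementaryOn (R : Type*) [CommRing R] (S : Finset m) : Subgroup (GL m R) :=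
  Subgroup.closure
    {g | ∃ i ∈ S, ∃ j, i ≠ j ∧ ∃ c : R, (g : Matrix m m R) = transvection i j c}

theorem glTransvection_mem_elementaryOn {S : Finset m} {i j : m} (hi : i ∈ S) (hij : i ≠ j)
    (c : R) : glTransvection hij c ∈ elementaryOn R S :=
  Subgroup.subset_closure ⟨i, hi, j, hij, c, rfl⟩

theorem elementaryOn_mono {S T : Finset m} (h : S ⊆ T) :
    elementaryOn R S ≤ elementaryOn R T :=
  Subgroup.closure_mono fun _ ⟨i, hi, hg⟩ => ⟨i, h hi, hg⟩

theorem elementaryOn_univ {n : ℕ} : elementaryOn R Finset.univ = elementary n R := by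
  simp [elementaryOn, elementary]

theorem elementaryOn_le_rowStabilizer {S : Finset m} {a : m} (ha : a ∉ S) :
    elementaryOn R S ≤ rowStabilizer (Pi.single a 1 : m → R) := by
  refine (Subgroup.closure_le _).2 ?_
  rintro g ⟨i, hi, j, -, c, hg⟩
  have hia : i ≠ a := ne_of_mem_of_not_mem hi ha
  rw [SetLike.mem_coe, mem_rowStabilizer, hg, vecMul_transvection]
  simp [hia]

theorem elementaryOn_le_ker_det (S : Finset m) :
    elementaryOn R S ≤ (GeneralLinearGroup.det (n := m) (R := R)).ker := by
  refine (Subgroup.closure_le _).2 ?_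
  rintro g ⟨i, -, j, hij, c, hg⟩
  exact Units.ext (by simp [hg, det_transvection_of_ne i j hij])

theorem inv_mulVec_apply_eq_zero {g : GL m R} {w : m → R} {a : m}
    (hg : g ∈ rowStabilizer (Pi.single a 1)) (ha : w a = 0) :
    ((g⁻¹ : GL m R).val *ᵥ w) a = 0 := by
  rw [← single_one_dotProduct a (_ *ᵥ w), dotProduct_mulVec,
    mem_rowStabilizer.1 (inv_mem hg), single_one_dotProduct, ha]

theorem apply_self_of_det_eq_one {g : GL m R} {k : m}
    (hg : ∀ a, a ≠ k → g ∈ rowStabilizer (Pi.single a 1)) (hdet : GeneralLinearGroup.det g = 1) :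
    g k k = 1 := by
  have hg1 : (g : Matrix m m R) = updateRow 1 k (g k) := by
    refine ext_of_single_vecMul fun a => ?_
    obtain rfl | ha := eq_or_ne a k
    · simp [row]
    · rw [mem_rowStabilizer.1 (hg a ha)]
      ext
      simp [row, ha, one_eq_pi_single]
  have hdet1 : (g : Matrix m m R).det = 1 := congrArg Units.val hdet
  rw [hg1, ← cramer_transpose_apply, transpose_one, cramer_one] at hdet1
  exact hdet1

variable {S : Finset m}

theorem exists_elementaryOn_apply_eq_one {v : m → R} {i j : m} (hi : i ∈ S) (hij : i ≠ j)
    (hv : IsUnit (v i)) : ∃ g ∈ elementaryOn R S, (v ᵥ* (g : Matrix m m R)) j = 1 := by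
  obtain ⟨u, hu⟩ := hv
  refine ⟨_, glTransvection_mem_elementaryOn hi hij (↑u⁻¹ * (1 - v j)), ?_⟩
  simp [vecMul_transvection, ← hu]

theorem exists_elementaryOn_of_apply_eq_one {v : m → R} {k : m} (hk : k ∈ S) (hv : v k = 1) :
    ∃ g ∈ elementaryOn R S, v ᵥ* (g : Matrix m m R) = Pi.single k 1 := by
  have hdisj : ∀ i, (Pi.single k 1 : m → R) i = 0 ∨ (Pi.single k 1 - v : m → R) i = 0 := fun i =>
    (eq_or_ne i k).symm.imp (by simp [·]) (by rintro rfl; simp [hv])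
  obtain ⟨g, hg, hgv⟩ := one_add_vecMulVec_mem_of_disjoint (M := matrices (elementaryOn R S)) hdisj
    fun i j hij => by
      obtain rfl | hi := eq_or_ne i k
      · exact ⟨_, glTransvection_mem_elementaryOn hk hij _, rfl⟩
      · simp [hi, one_mem]
  refine ⟨g, hg, ?_⟩
  rw [show (g : Matrix m m R) = _ from hgv, vecMul_one_add_vecMulVec, dotProduct_single_one, hv,
    one_smul, add_sub_cancel]

theorem exists_elementaryOn_of_isUnit {v : m → R} {i k l : m} (hi : i ∈ S) (hk : k ∈ S)
    (hl : l ∈ S) (hkl : k ≠ l) (hv : IsUnit (v i)) :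
    ∃ g ∈ elementaryOn R S, v ᵥ* (g : Matrix m m R) = Pi.single k 1 := by
  have of_ne : ∀ {w : m → R} {j}, j ∈ S → j ≠ k → IsUnit (w j) →
      ∃ g ∈ elementaryOn R S, w ᵥ* (g : Matrix m m R) = Pi.single k 1 := fun hj hjk hw => by
    obtain ⟨g, hg, hgk⟩ := exists_elementaryOn_apply_eq_one hj hjk hw
    obtain ⟨h, hh, e⟩ := exists_elementaryOn_of_apply_eq_one hk hgk
    exact ⟨g * h, mul_mem hg hh, by rw [Units.val_mul, ← vecMul_vecMul, e]⟩
  obtain rfl | hik := eq_or_ne i k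
  · obtain ⟨g, hg, hgl⟩ := exists_elementaryOn_apply_eq_one hi hkl hv
    obtain ⟨h, hh, e⟩ := of_ne hl hkl.symm (hgl ▸ isUnit_one)
    exact ⟨g * h, mul_mem hg hh, by rw [Units.val_mul, ← vecMul_vecMul, e]⟩
  · exact of_ne hi hik hv

end Subgroups

variable [EuclideanDomain R] {S : Finset m}

-- Among the nonzero entries in `S` of the rows in the orbit of `v`, a minimal one divides the
-- other entries in `S` of its row.
theorem exists_elementaryOn_isUnit {v w : m → R} (hw : v ⬝ᵥ w = 1) (hS : ∀ a ∉ S, w a = 0) :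
    ∃ g ∈ elementaryOn R S, ∃ i ∈ S, IsUnit ((v ᵥ* (g : Matrix m m R)) i) := by
  have dvd_one : ∀ g ∈ elementaryOn R S, ∀ x : R,
      (∀ i ∈ S, x ∣ (v ᵥ* (g : Matrix m m R)) i) → x ∣ 1 := fun g hg x hx => by
    rw [← hw, ← dotProduct_inv_mulVec v w g]
    refine Finset.dvd_sum fun i _ => ?_
    by_cases hi : i ∈ S
    · exact (hx i hi).mul_right _
    · rw [inv_mulVec_apply_eq_zero (elementaryOn_le_rowStabilizer hi hg) (hS i hi), mul_zero]
      exact dvd_zero x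
  let entries : Set R :=
    {x | x ≠ 0 ∧ ∃ g ∈ elementaryOn R S, ∃ i ∈ S, (v ᵥ* (g : Matrix m m R)) i = x}
  have entries_nonempty : entries.Nonempty := by
    by_contra hempty
    refine zero_ne_one (zero_dvd_iff.1 (dvd_one 1 (one_mem _) 0 fun i hi => ?_)).symm
    by_contra hne
    exact hempty ⟨_, fun h => hne (h ▸ dvd_rfl), 1, one_mem _, i, hi, rfl⟩
  obtain ⟨x, ⟨hx, g, hg, i, hi, rfl⟩, hmin⟩ :=
    EuclideanDomain.r_wellFounded.has_min entries entries_nonempty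
  refine ⟨g, hg, i, hi, isUnit_of_dvd_one (dvd_one g hg _ fun j hj => ?_)⟩
  obtain rfl | hij := eq_or_ne i j
  · exact dvd_rfl
  set u := v ᵥ* (g : Matrix m m R)
  by_contra hdvd
  refine hmin (u j % u i) ⟨fun h => hdvd (EuclideanDomain.mod_eq_zero.1 h),
    g * glTransvection hij (-(u j / u i)),
    mul_mem hg (glTransvection_mem_elementaryOn hi hij _), j, hj, ?_⟩ (EuclideanDomain.mod_lt _ hx)
  simp [← vecMul_vecMul, vecMul_transvection, EuclideanDomain.mod_eq_sub_mul_div, u,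
    sub_eq_add_neg]

theorem exists_elementaryOn_vecMul_eq_single {k l : m} (hk : k ∈ S) (hl : l ∈ S) (hkl : k ≠ l)
    {v w : m → R} (hw : v ⬝ᵥ w = 1) (hS : ∀ a ∉ S, w a = 0) :
    ∃ g ∈ elementaryOn R S, v ᵥ* (g : Matrix m m R) = Pi.single k 1 := by
  obtain ⟨g, hg, i, hi, hu⟩ := exists_elementaryOn_isUnit hw hS
  obtain ⟨h, hh, e⟩ := exists_elementaryOn_of_isUnit hi hk hl hkl hu
  exact ⟨g * h, mul_mem hg hh, by rw [Units.val_mul, ← vecMul_vecMul, e]⟩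

theorem mem_elementaryOn {g : GL m R} (hdet : GeneralLinearGroup.det g = 1)
    (hg : ∀ a ∉ S, g ∈ rowStabilizer (Pi.single a 1)) : g ∈ elementaryOn R S := by
  induction S using Finset.induction_on generalizing g with
  | empty =>
    rw [eq_one_of_forall_mem_rowStabilizer fun a => hg a (Finset.notMem_empty a)]
    exact one_mem _
  | insert k S hkS ih =>
    have hk := Finset.mem_insert_self k S
    obtain ⟨h, hh, hgh⟩ : ∃ h ∈ elementaryOn R (insert k S),
        (Pi.single k 1 ᵥ* (g : Matrix m m R)) ᵥ* (h : Matrix m m R) = Pi.single k 1 := by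
      obtain rfl | ⟨l, hl⟩ := S.eq_empty_or_nonempty
      · refine exists_elementaryOn_of_apply_eq_one hk ?_
        simpa [single_one_vecMul] using apply_self_of_det_eq_one (fun a ha => hg a (by simpa)) hdet
      · refine exists_elementaryOn_vecMul_eq_single hk (Finset.mem_insert_of_mem hl)
          (ne_of_mem_of_not_mem hl hkS).symm (w := (g⁻¹ : GL m R).val *ᵥ Pi.single k 1)
          (by rw [dotProduct_inv_mulVec, single_one_dotProduct, Pi.single_eq_same]) fun a ha => ?_
        exact inv_mulVec_apply_eq_zero (hg a ha)
          (Pi.single_eq_of_ne (ne_of_mem_of_not_mem hk ha).symm 1)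
    have hgS : g * h ∈ elementaryOn R S := by
      refine ih (by rw [map_mul, hdet, one_mul, elementaryOn_le_ker_det _ hh]) fun a ha => ?_
      obtain rfl | hak := eq_or_ne a k
      · rwa [mem_rowStabilizer, Units.val_mul, ← vecMul_vecMul]
      · have ha : a ∉ insert k S := by simp [hak, ha]
        exact mul_mem (hg a ha) (elementaryOn_le_rowStabilizer ha hh)
    simpa using mul_mem (elementaryOn_mono (Finset.subset_insert k S) hgS) (inv_mem hh)

variable {n : ℕ} [NeZero n]

theorem IsUnimodular.exists_elementary_vecMul_eq_single (hn : 1 < n) {v : Fin n → R}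
    (hv : IsUnimodular v) :
    ∃ g ∈ elementary n R, v ᵥ* (g : Matrix (Fin n) (Fin n) R) = Pi.single 0 1 := by
  have h01 : (0 : Fin n) ≠ 1 := by simp; omega
  obtain ⟨w, hw⟩ := hv
  rw [← elementaryOn_univ]
  exact exists_elementaryOn_vecMul_eq_single (Finset.mem_univ 0) (Finset.mem_univ 1) h01 hw
    (by simp)

theorem mem_elementaryOn_erase_zero {g : GL (Fin n) R} (hg : g ∈ elementary n R)
    (hfix : g ∈ rowStabilizer (Pi.single 0 1)) : g ∈ elementaryOn R (Finset.univ.erase 0) := by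
  rw [← elementaryOn_univ] at hg
  exact mem_elementaryOn (elementaryOn_le_ker_det _ hg) (by simpa using hfix)

end EuclideanDomains

section Augmented

open scoped commutatorElement

variable {n : ℕ} {A B : Type*} [CommRing A]

theorem commutatorElement_glTransvection {m : Type*} [DecidableEq m] [Fintype m] {i j k : m}
    (hik : i ≠ k) (hkj : k ≠ j) (hij : i ≠ j) (a b : A) :
    ⁅glTransvection hik a, glTransvection hkj b⁆ = glTransvection hij (a * b) := by
  rw [commutatorElement_def, inv_glTransvection, inv_glTransvection]
  refine Units.ext ?_
  simp [transvection, add_mul, mul_add, hik.symm, hkj.symm, hij.symm, ← single_neg]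
  abel

section Relative

variable [NeZero n] {J : Ideal A}

theorem conj_mem_elementaryRel {g e : GL (Fin n) A} (hg : g ∈ elementary n A)
    (he : e ∈ elementaryRel n A J) : g * e * g⁻¹ ∈ elementaryRel n A J := by
  obtain ⟨e, he, rfl⟩ := he
  exact ⟨_, Subgroup.normalClosure_normal.conj_mem e he ⟨g, hg⟩, rfl⟩

theorem commutatorElement_mem_elementaryRel {g e : GL (Fin n) A} (he : e ∈ elementaryRel n A J)
    (hg : g ∈ elementary n A) : ⁅e, g⁆ ∈ elementaryRel n A J := by
  rw [commutatorElement_def, mul_assoc, mul_assoc, ← mul_assoc g]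
  exact mul_mem he (conj_mem_elementaryRel hg (inv_mem he))

theorem glTransvection_mem_elementaryRel (hn : 2 < n) {i j : Fin n} (hij : i ≠ j) {x : A}
    (hx : x ∈ J) : glTransvection hij x ∈ elementaryRel n A J := by
  have h10 : (1 : Fin n) ≠ 0 := by simp; omega
  have base : glTransvection h10 x ∈ elementaryRel n A J :=
    ⟨⟨glTransvection h10 x, glTransvection_mem_elementary _ _⟩,
      Subgroup.subset_normalClosure ⟨x, hx, rfl⟩, rfl⟩
  have change_col : ∀ {a b c : Fin n} (hab : a ≠ b) (hac : a ≠ c),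
      glTransvection hab x ∈ elementaryRel n A J → glTransvection hac x ∈ elementaryRel n A J := by
    intro a b c hab hac hm
    obtain rfl | hbc := eq_or_ne b c
    · exact hm
    rw [← mul_one x, ← commutatorElement_glTransvection hab hbc hac]
    exact commutatorElement_mem_elementaryRel hm (glTransvection_mem_elementary _ _)
  have change_row : ∀ {a b c : Fin n} (hac : a ≠ c) (hbc : b ≠ c),
      glTransvection hac x ∈ elementaryRel n A J → glTransvection hbc x ∈ elementaryRel n A J := by
    intro a b c hac hbc hm
    obtain rfl | hba := eq_or_ne b a
    · exact hm
    rw [← one_mul x, ← commutatorElement_glTransvection hba hac hbc, ← commutatorElement_inv]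
    exact inv_mem (commutatorElement_mem_elementaryRel hm (glTransvection_mem_elementary _ _))
  obtain rfl | hi := eq_or_ne i 0
  · obtain ⟨k, hk0, hkj⟩ := Fin.exists_ne_and_ne_of_two_lt 0 j hn
    exact change_row hkj hij (change_col hk0 hkj (change_row h10 hk0 base))
  · exact change_col hi hij (change_row h10 hi base)

end Relative

section StabilizerLift

variable [CommRing B] {π : A →+* B} {u : Fin n → A}

theorem glTransvection_mem_map_rowStabilizer {i j : Fin n} (hij : i ≠ j) {s z : Fin n → A} {c : B}
    (hus : u ⬝ᵥ s = 0) (hs : π ∘ s = Pi.single i 1) (hz : π ∘ z = Pi.single j c)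
    (hsz : 1 + vecMulVec s z ∈ matrices (elementary n A)) :
    glTransvection hij c ∈
      (elementary n A ⊓ rowStabilizer u).map (GeneralLinearGroup.map π) := by
  obtain ⟨g, hg, hgM⟩ := hsz
  have hgM : (g : Matrix (Fin n) (Fin n) A) = 1 + vecMulVec s z := hgM
  refine ⟨g, ⟨hg, ?_⟩, Units.ext ?_⟩
  · change u ᵥ* _ = u
    rw [hgM, vecMul_one_add_vecMulVec, hus, zero_smul, add_zero]
  · change (g : Matrix (Fin n) (Fin n) A).map π = transvection i j c
    rw [hgM, ← one_mul c, ← one_add_vecMulVec_single_single, ← hs, ← hz]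
    ext a b
    simp [Matrix.one_apply, vecMulVec_apply, apply_ite π]

variable [NeZero n]

theorem isBasedRow_ker_iff {v : Fin n → A} :
    IsBasedRow (RingHom.ker π) v ↔ π ∘ v = Pi.single 0 1 := by
  refine Iff.trans (forall_congr' fun i => ?_) funext_iff.symm
  rw [RingHom.sub_mem_ker_iff]
  obtain rfl | hi := eq_or_ne i 0 <;> simp [*]

theorem glTransvection_mem_map_rowStabilizer_of_isBasedRow (hn : 2 < n)
    (hu : IsBasedRow (RingHom.ker π) u) {i j : Fin n} (hi : i ≠ 0) (hij : i ≠ j) (c : A) :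
    glTransvection hij (π c) ∈
      (elementary n A ⊓ rowStabilizer u).map (GeneralLinearGroup.map π) := by
  have hπ := isBasedRow_ker_iff.1 hu
  have hu0 : π (u 0) = 1 := by simpa using congrFun hπ 0
  have hui : π (u i) = 0 := by simpa [hi] using congrFun hπ i
  have hs0 : ∀ k, k ≠ i → k ≠ 0 → koszulRow u 0 i k = 0 := fun k hki hk0 => by
    simp [koszulRow, hki, hk0]
  have hus : u ⬝ᵥ koszulRow u 0 i = 0 := by simp [koszulRow, mul_comm]
  have hs : π ∘ koszulRow u 0 i = Pi.single i 1 := by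
    ext k
    simp [koszulRow, hu0, hui, Pi.single_apply, apply_ite π]
  have mem : ∀ {a b : Fin n}, a ≠ b → ∀ x, transvection a b x ∈ matrices (elementary n A) :=
    fun hab x => ⟨_, glTransvection_mem_elementary hab x, rfl⟩
  obtain rfl | hj := eq_or_ne j 0
  · obtain ⟨k, hki, hk0⟩ := Fin.exists_ne_and_ne_of_two_lt i 0 hn
    refine glTransvection_mem_map_rowStabilizer hij (z := Pi.single 0 (c * u 0) +
      Pi.single i (c * u i)) hus hs ?_ (one_add_vecMulVec_mem_of_orthogonal (hs0 k hki hk0)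
        (by simp [hki, hk0]) ?_ (fun a ha _ => mem ha _) fun b hb _ => mem hb _)
    · ext a
      simp [hu0, hui, Pi.single_apply, apply_ite π]
    · simp [koszulRow, hi, hi.symm]
      ring
  · refine glTransvection_mem_map_rowStabilizer hij (z := Pi.single j c) hus hs ?_
      (one_add_vecMulVec_mem_of_disjoint (fun k => ?_) fun a b hab => mem hab _)
    · ext a
      simp [Pi.single_apply, apply_ite π]
    · obtain rfl | hk := eq_or_ne k j
      · exact .inl (hs0 k hij.symm hj)
      · simp [hk]

end StabilizerLift

section RingSection

variable [NeZero n] [CommRing B] {π : A →+* B} {ι : B →+* A}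

theorem mul_inv_map_mem_elementaryRel_ker (hn : 2 < n) (hι : Function.LeftInverse π ι)
    {g : GL (Fin n) A} (hg : g ∈ elementary n A) :
    g * (GeneralLinearGroup.map ι (GeneralLinearGroup.map π g))⁻¹ ∈
      elementaryRel n A (RingHom.ker π) := by
  unfold elementary at hg
  induction hg using Subgroup.closure_induction with
  | mem g hg =>
    obtain ⟨i, j, hij, c, hc⟩ := hg
    obtain rfl : g = glTransvection hij c := Units.ext hc
    have hmem : c - ι (π c) ∈ RingHom.ker π := by simp [RingHom.mem_ker, hι (π c)]
    convert glTransvection_mem_elementaryRel hn hij hmem using 1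
    rw [mul_inv_eq_iff_eq_mul]
    refine Units.ext ?_
    change transvection i j c = transvection i j _ * ((transvection i j c).map π).map ι
    rw [transvection_map, transvection_map, transvection_mul_transvection_same _ _ hij,
      sub_add_cancel]
  | one => simp [one_mem]
  | mul a b ha _ iha ihb =>
    convert mul_mem (conj_mem_elementaryRel ha ihb) iha using 1
    simp only [map_mul, _root_.mul_inv_rev]
    group
  | inv a ha iha =>
    convert conj_mem_elementaryRel (inv_mem ha) (inv_mem iha) using 1
    simp only [map_inv, _root_.mul_inv_rev]
    group

end RingSection

variable [NeZero n] [EuclideanDomain B] {π : A →+* B} {ι : B →+* A}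

-- Over `B` the stabilizer of `e₁` is generated by elementary matrices that lift to the stabilizer
-- of `v`, so the given element of `E_n(A)` can be corrected to one with trivial image over `B`.
theorem RowEquiv.exists_elementaryRel_ker (hn : 2 < n) (hι : Function.LeftInverse π ι)
    {v w : Fin n → A} (hv : IsBasedRow (RingHom.ker π) v) (hw : IsBasedRow (RingHom.ker π) w)
    (h : RowEquiv v w) : ∃ g ∈ elementaryRel n A (RingHom.ker π),
      v ᵥ* (g : Matrix (Fin n) (Fin n) A) = w := by
  obtain ⟨g, hg, hgv⟩ := h
  have hfix : GeneralLinearGroup.map π g ∈ rowStabilizer (Pi.single 0 1) := by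
    rw [mem_rowStabilizer, ← isBasedRow_ker_iff.1 hv, vecMul_map, hgv, isBasedRow_ker_iff.1 hv,
      isBasedRow_ker_iff.1 hw]
  have hle : elementaryOn B (Finset.univ.erase 0) ≤
      (elementary n A ⊓ rowStabilizer v).map (GeneralLinearGroup.map π) := by
    refine (Subgroup.closure_le _).2 ?_
    rintro e ⟨i, hi, j, hij, c, he⟩
    obtain rfl : e = glTransvection hij c := Units.ext he
    rw [← hι c]
    exact glTransvection_mem_map_rowStabilizer_of_isBasedRow hn hv (Finset.ne_of_mem_erase hi) hij _
  obtain ⟨θ, ⟨hθ, hθv⟩, hθπ⟩ := hle (mem_elementaryOn_erase_zero (elementary_map π hg) hfix)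
  refine ⟨θ⁻¹ * g, ?_, ?_⟩
  · simpa [hθπ] using mul_inv_map_mem_elementaryRel_ker hn hι (mul_mem (inv_mem hθ) hg)
  · rw [Units.val_mul, ← vecMul_vecMul, mem_rowStabilizer.1 (inv_mem hθv), hgv]

theorem toMSE_bijective (hn : 2 < n) (hι : Function.LeftInverse π ι) :
    Function.Bijective (MSERel.toMSE n (RingHom.ker π)) := by
  refine ⟨?_, ?_⟩
  · rintro ⟨v, hv⟩ ⟨w, hw⟩ h
    exact Quotient.sound (RowEquiv.exists_elementaryRel_ker hn hι (mem_umRel_iff.1 hv).2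
      (mem_umRel_iff.1 hw).2 (Quotient.exact h))
  · rintro ⟨v, hv⟩
    obtain ⟨g, hg, hgv⟩ := (hv.map π).exists_elementary_vecMul_eq_single (by omega)
    set g' := GeneralLinearGroup.map ι g
    have hg' : GeneralLinearGroup.map π g' = g := Units.ext <| by ext; simp [g', hι _]
    have hbased : IsBasedRow (RingHom.ker π) (v ᵥ* (g' : Matrix (Fin n) (Fin n) A)) := by
      rw [isBasedRow_ker_iff, ← vecMul_map, hg', hgv]
    have hequiv : RowEquiv v (v ᵥ* (g' : Matrix (Fin n) (Fin n) A)) :=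
      ⟨g', elementary_map ι hg, rfl⟩
    exact ⟨MSERel.mk ⟨_, mem_umRel_iff.2 ⟨hv.vecMul g', hbased⟩⟩, Quotient.sound hequiv.symm⟩

end Augmented

section ExcisionTheorem

variable {n : ℕ} [NeZero n] {A R : Type*} [CommRing A] [CommRing R] {φ : A →+* R}

theorem map_bijective_of_leftInverse {B : Type*} [EuclideanDomain B] {π : A →+* B} {ι : B →+* A}
    {I : Ideal R} (hn : 2 < n) (hι : Function.LeftInverse π ι)
    (h : Set.BijOn φ (RingHom.ker π) I) : Function.Bijective (MSERel.map n φ h.mapsTo) := by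
  refine ⟨?_, ?_⟩
  · rintro ⟨v, hv⟩ ⟨w, hw⟩ e
    obtain ⟨g, hg, hgv⟩ := Quotient.exact e
    exact Quotient.sound (RowEquiv.exists_elementaryRel_ker hn hι (mem_umRel_iff.1 hv).2
      (mem_umRel_iff.1 hw).2 (rowEquiv_of_comp_vecMul_eq h hn hv hw hg hgv))
  · rintro ⟨v, hv⟩
    obtain ⟨u, hu, rfl⟩ := exists_umRel_lift h hv
    exact ⟨MSERel.mk ⟨u, hu⟩, rfl⟩

theorem bijOn_zHom (I : Ideal R) : Set.BijOn (zHom I) (zIdeal I) I := by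
  refine ⟨zIdeal_le I, fun x hx y hy e => ?_, fun y hy => ⟨Unitization.inr ⟨y, hy⟩, rfl, ?_⟩⟩
  · have hx : x.fst = 0 := hx
    have hy : y.fst = 0 := hy
    exact Unitization.ext (hx.trans hy.symm) (Subtype.ext (by simpa [zHom, hx, hy] using e))
  · simp [zHom]

theorem bijOn_rHom (I : Ideal R) : Set.BijOn (rHom I) (rIdeal I) I := by
  refine ⟨rIdeal_le I, fun x hx y hy e => ?_, fun y hy => ⟨Unitization.inr ⟨y, hy⟩, rfl, ?_⟩⟩
  · have hx : x.fst = 0 := hx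
    have hy : y.fst = 0 := hy
    exact Unitization.ext (hx.trans hy.symm) (Subtype.ext (by simpa [rHom, hx, hy] using e))
  · simp [rHom]

theorem leftInverse_fstHom_castRingHom (I : Ideal R) : Function.LeftInverse
    (Unitization.fstHom ℤ I : ZPlus I →+* ℤ) (Int.castRingHom (ZPlus I)) :=
  fun k => map_intCast (Unitization.fstHom ℤ I : ZPlus I →+* ℤ) k

theorem mapF_bijective (I : Ideal R) (hn : 2 < n) : Function.Bijective (mapF I n) :=
  map_bijective_of_leftInverse hn (leftInverse_fstHom_castRingHom I) (bijOn_zHom I)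

theorem mapG_bijective (I : Ideal R) (hn : 2 < n) : Function.Bijective (mapG I n) :=
  toMSE_bijective hn (leftInverse_fstHom_castRingHom I)

theorem map_bijective {J : Ideal A} {I : Ideal R} (hn : 2 < n) (h : Set.BijOn φ J I) :
    Function.Bijective (MSERel.map n φ h.mapsTo) := by
  have hcomp : Set.BijOn (φ.comp (zHom J)) (zIdeal J) I := h.comp (bijOn_zHom J)
  have hmap : MSERel.map n φ h.mapsTo ∘ mapF J n = MSERel.map n (φ.comp (zHom J)) hcomp.mapsTo :=
    funext (Quotient.ind fun _ => rfl)
  rw [← Function.Bijective.of_comp_iff _ (mapF_bijective J hn), hmap]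
  exact map_bijective_of_leftInverse hn (leftInverse_fstHom_castRingHom J) hcomp

end ExcisionTheorem

section Naturality

variable {n : ℕ} [NeZero n] {A R : Type*} [CommRing A] [CommRing R] {φ : A →+* R} {J : Ideal A}
  {I : Ideal R}

/-- The map `ℤ ⊕ J → ℤ ⊕ I`, `(m, j) ↦ (m, φ j)`, induced by a ring homomorphism `φ` that maps the
ideal `J` into the ideal `I`. -/
def zPlusMap (φ : A →+* R) (h : J ≤ I.comap φ) : ZPlus J →+* ZPlus I where
  toFun x := Unitization.inl x.fst + Unitization.inr ⟨φ x.snd, h x.snd.2⟩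
  map_one' := by ext <;> simp
  map_zero' := by ext <;> simp
  map_add' x y := by ext <;> simp
  map_mul' x y := by ext <;> simp

theorem phi_eq_zPlusMap (I : Ideal R) : phi I = zPlusMap (rHom I) (rIdeal_le I) := by
  ext x
  · simp [phi, zPlusMap]
  · have hx : (x.snd : RPlus I).fst = 0 := x.snd.2
    simp [phi, zPlusMap, rHom, hx]

theorem zIdeal_le_comap_zPlusMap (h : J ≤ I.comap φ) :
    zIdeal J ≤ (zIdeal I).comap (zPlusMap φ h) := fun x hx => by
  have hx : x.fst = 0 := hx
  change (zPlusMap φ h x).fst = 0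
  simp [zPlusMap, hx]

theorem zHom_zPlusMap (h : J ≤ I.comap φ) (x : ZPlus J) :
    zHom I (zPlusMap φ h x) = φ (zHom J x) := by
  simp [zHom, zPlusMap]

theorem mapF_map_zPlusMap (h : J ≤ I.comap φ) (x : MSERel n (ZPlus J) (zIdeal J)) :
    mapF I n (MSERel.map n (zPlusMap φ h) (zIdeal_le_comap_zPlusMap h) x) =
      MSERel.map n φ h (mapF J n x) := by
  obtain ⟨v, hv⟩ := x
  exact congrArg MSERel.mk (Subtype.ext (funext fun i => zHom_zPlusMap h (v i)))

theorem mapG_map_zPlusMap (h : J ≤ I.comap φ) (x : MSERel n (ZPlus J) (zIdeal J)) :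
    mapG I n (MSERel.map n (zPlusMap φ h) (zIdeal_le_comap_zPlusMap h) x) =
      MSE.map n (zPlusMap φ h) (mapG J n x) := by
  obtain ⟨v, hv⟩ := x
  rfl

theorem map_zPlusMap_bijective (hn : 2 < n) (h : Set.BijOn φ J I) :
    Function.Bijective (MSE.map n (zPlusMap φ h.mapsTo)) := by
  have hrel : Function.Bijective (MSERel.map n (zPlusMap φ h.mapsTo)
      (zIdeal_le_comap_zPlusMap h.mapsTo)) := by
    rw [← Function.Bijective.of_comp_iff' (mapF_bijective I hn)]
    convert (map_bijective hn h).comp (mapF_bijective J hn) using 1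
    exact funext (mapF_map_zPlusMap h.mapsTo)
  rw [← Function.Bijective.of_comp_iff _ (mapG_bijective J hn)]
  convert (mapG_bijective I hn).comp hrel using 1
  exact (funext (mapG_map_zPlusMap h.mapsTo)).symm

end Naturality

section VasersteinVanDerKallen

variable {n : ℕ} [NeZero n] {A R : Type*} [CommRing A] [CommRing R] {φ : A →+* R}

theorem comp_vvRow (φ : A →+* R) (v : Fin n → A) (b p : A) :
    φ ∘ vvRow v b p = vvRow (φ ∘ v) (φ b) (φ p) := by
  ext i
  simp only [vvRow, Function.comp_apply]
  split_ifs <;> simp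

theorem IsUnimodular.exists_mul_sub_one_mem_span {v : Fin n → R} (hv : IsUnimodular v) :
    ∃ p, v 0 * p - 1 ∈ Ideal.span (v '' {i | i ≠ 0}) := by
  obtain ⟨w, hw⟩ := hv
  have h : v 0 * w 0 - 1 = -∑ i ∈ Finset.univ.erase 0, v i * w i := by
    rw [← hw, dotProduct, ← Finset.add_sum_erase _ _ (Finset.mem_univ 0), sub_add_cancel_left]
  refine ⟨w 0, h ▸ neg_mem (Ideal.sum_mem _ fun i hi => Ideal.mul_mem_right _ _ ?_)⟩
  exact Ideal.subset_span ⟨i, Finset.ne_of_mem_erase hi, rfl⟩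

theorem map_op_of_commonTail (φ : A →+* R) {opA : MSE n A → MSE n A → MSE n A}
    {opR : MSE n R → MSE n R → MSE n R} (hA : FollowsVv opA) (hR : FollowsVv opR) {x y : MSE n A}
    (hxy : CommonTail x y) : MSE.map n φ (opA x y) = opR (MSE.map n φ x) (MSE.map n φ y) := by
  obtain ⟨v, w, rfl, rfl, e⟩ := hxy
  obtain ⟨p, hp⟩ := IsUnimodular.exists_mul_sub_one_mem_span v.2
  have hφp : (φ ∘ v.1) 0 * φ p - 1 ∈ Ideal.span ((φ ∘ v.1) '' {i | i ≠ 0}) := by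
    simpa [Ideal.map_span, ← Set.image_comp] using Ideal.mem_map_of_mem φ hp
  obtain ⟨_, hvw⟩ := hA v w e p hp
  obtain ⟨_, hφvw⟩ := hR ⟨φ ∘ v.1, IsUnimodular.map φ v.2⟩ ⟨φ ∘ w.1, IsUnimodular.map φ w.2⟩
    (fun i hi => congrArg φ (e i hi)) (φ p) hφp
  rw [hvw]
  exact (congrArg MSE.mk (Subtype.ext (comp_vvRow φ _ _ _))).trans hφvw.symm

variable {J : Ideal A} {I : Ideal R}

theorem map_op_of_commonTailRel (hn : 2 < n) (h : J ≤ I.comap φ)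
    {opA : MSERel n A J → MSERel n A J → MSERel n A J}
    {opR : MSERel n R I → MSERel n R I → MSERel n R I}
    (hA : FollowsVvRel J opA) (hR : FollowsVvRel I opR) {x y : MSERel n A J}
    (hxy : CommonTailRel J x y) :
    MSERel.map n φ h (opA x y) = opR (MSERel.map n φ h x) (MSERel.map n φ h y) := by
  obtain ⟨opA', hopA, hA'⟩ := hA
  obtain ⟨opR', hopR, hR'⟩ := hR
  obtain ⟨x, y, rfl, rfl, hxy⟩ := hxy
  set Φ := MSERel.map n (zPlusMap φ h) (zIdeal_le_comap_zPlusMap h)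
  have hF (x) : MSERel.map n φ h (mapF J n x) = mapF I n (Φ x) := (mapF_map_zPlusMap h x).symm
  have hG (x) : MSE.map n (zPlusMap φ h) (mapG J n x) = mapG I n (Φ x) :=
    (mapG_map_zPlusMap h x).symm
  obtain ⟨z, hz⟩ := (mapF_bijective J hn).2 (opA (mapF J n x) (mapF J n y))
  obtain ⟨t, ht⟩ := (mapF_bijective I hn).2 (opR (mapF I n (Φ x)) (mapF I n (Φ y)))
  have hzt : Φ z = t := (mapG_bijective I hn).1 <| by
    rw [← hopR _ _ t ht, ← hG, ← hopA x y z hz, map_op_of_commonTail _ hA' hR' hxy, hG, hG]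
  rw [← hz, hF, hF, hF, hzt, ht]

theorem apply_eq_of_comp_apply_eq (h : Set.BijOn φ J I) {v w : Fin n → A}
    (hv : v ∈ UmRel n A J) (hw : w ∈ UmRel n A J) {i : Fin n} (hi : i ≠ 0)
    (e : φ (w i) = φ (v i)) : w i = v i :=
  eq_of_bijOn h (J.sub_mem (hw.2.2 i hi) (hv.2.2 i hi)) e

theorem commonTailRel_mk {v w : UmRel n R I} (e : ∀ i, i ≠ 0 → w.1 i = v.1 i) :
    CommonTailRel I (MSERel.mk w) (MSERel.mk v) := by
  obtain ⟨v, hv⟩ := v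
  obtain ⟨w, hw⟩ := w
  obtain ⟨v, hvZ, rfl⟩ := exists_umRel_lift (bijOn_zHom I) hv
  obtain ⟨w, hwZ, rfl⟩ := exists_umRel_lift (bijOn_zHom I) hw
  exact ⟨MSERel.mk ⟨w, hwZ⟩, MSERel.mk ⟨v, hvZ⟩, rfl, rfl, ⟨v, hvZ.1⟩, ⟨w, hwZ.1⟩, rfl, rfl,
    fun i hi => apply_eq_of_comp_apply_eq (bijOn_zHom I) hvZ hwZ hi (e i hi)⟩

theorem comp_update_mul (φ : A →+* R) (v w : Fin n → A) :
    φ ∘ Function.update v 0 (v 0 * w 0) =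
      Function.update (φ ∘ v) 0 ((φ ∘ v) 0 * (φ ∘ w) 0) := by
  rw [Function.comp_update, map_mul]
  rfl

theorem IsBasedRow.update_mul {v w : Fin n → R} (hv : IsBasedRow I v) (hw : IsBasedRow I w) :
    IsBasedRow I (Function.update v 0 (v 0 * w 0)) := fun i => by
  obtain rfl | hi := eq_or_ne i 0
  · have h : v 0 * w 0 - 1 = v 0 * (w 0 - 1) + (v 0 - 1) := by ring
    simpa [h] using I.add_mem (I.mul_mem_left (v 0) (hw 0)) (hv 0)
  · simpa [hi] using hv.apply_mem hi

theorem comp_mem_umRel (h : J ≤ I.comap φ) {v : Fin n → A} (hv : v ∈ UmRel n A J) :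
    φ ∘ v ∈ UmRel n R I :=
  ⟨IsUnimodular.map φ hv.1, by simpa using h hv.2.1, fun i hi => h (hv.2.2 i hi)⟩

theorem mem_umRel_of_comp_mem_umRel (h : Set.BijOn φ J I) {v : Fin n → A} (hv : IsBasedRow J v)
    (hφv : φ ∘ v ∈ UmRel n R I) : v ∈ UmRel n A J := by
  obtain ⟨u, hu, e⟩ := exists_umRel_lift h hφv
  rwa [← (mem_umRel_iff.1 hu).2.eq_of_comp_eq h hv e]

variable {opA : MSERel n A J → MSERel n A J → MSERel n A J}
  {opR : MSERel n R I → MSERel n R I → MSERel n R I}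

theorem IsNiceRel.map (hn : 2 < n) (h : Set.BijOn φ J I) (hA : FollowsVvRel J opA)
    (hR : FollowsVvRel I opR) (hnice : IsNiceRel J opA) : IsNiceRel I opR := by
  rintro ⟨v, hv⟩ ⟨w, hw⟩ e
  obtain ⟨v, hvJ, rfl⟩ := exists_umRel_lift h hv
  obtain ⟨w, hwJ, rfl⟩ := exists_umRel_lift h hw
  have e' : ∀ i, i ≠ 0 → w i = v i := fun i hi => apply_eq_of_comp_apply_eq h hvJ hwJ hi (e i hi)
  obtain ⟨hm, hprod⟩ := hnice ⟨v, hvJ⟩ ⟨w, hwJ⟩ e'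
  have hφ := map_op_of_commonTailRel hn h.mapsTo hA hR
    (commonTailRel_mk (v := ⟨v, hvJ⟩) (w := ⟨w, hwJ⟩) e')
  rw [hprod] at hφ
  exact ⟨comp_update_mul φ v w ▸ comp_mem_umRel h.mapsTo hm,
    hφ.symm.trans (congrArg MSERel.mk (Subtype.ext (comp_update_mul φ v w)))⟩

theorem IsNiceRel.comap (hn : 2 < n) (h : Set.BijOn φ J I) (hA : FollowsVvRel J opA)
    (hR : FollowsVvRel I opR) (hnice : IsNiceRel I opR) : IsNiceRel J opA := by
  rintro ⟨v, hv⟩ ⟨w, hw⟩ e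
  obtain ⟨hm, hprod⟩ := hnice ⟨_, comp_mem_umRel h.mapsTo hv⟩ ⟨_, comp_mem_umRel h.mapsTo hw⟩
    fun i hi => congrArg φ (e i hi)
  have hφ := map_op_of_commonTailRel hn h.mapsTo hA hR
    (commonTailRel_mk (v := ⟨v, hv⟩) (w := ⟨w, hw⟩) e)
  have hbased := (mem_umRel_iff.1 hv).2.update_mul (mem_umRel_iff.1 hw).2
  refine ⟨mem_umRel_of_comp_mem_umRel h hbased (comp_update_mul φ v w ▸ hm),
    (map_bijective hn h).1 (hφ.trans (hprod.trans ?_))⟩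
  exact congrArg MSERel.mk (Subtype.ext (comp_update_mul φ v w).symm)

theorem isNiceRel_iff (hn : 2 < n) (h : Set.BijOn φ J I) (hA : FollowsVvRel J opA)
    (hR : FollowsVvRel I opR) : IsNiceRel J opA ↔ IsNiceRel I opR :=
  ⟨.map hn h hA hR, .comap hn h hA hR⟩

end VasersteinVanDerKallen

end Excision

end

open Excision in
theorem mainTheorem6_general {A R : Type*} [CommRing A] [CommRing R] (φ : A →+* R) (J : Ideal A)
    (I : Ideal R) (h : Set.BijOn φ J I) (n : ℕ) [NeZero n] (hn : 3 ≤ n) :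
    (Function.Bijective (mapF J n) ∧
      Function.Bijective (mapG J n) ∧
      Function.Bijective (MSE.map n (zPlusMap φ h.mapsTo)) ∧
      Function.Bijective (mapG I n) ∧
      Function.Bijective (mapF I n) ∧
      Function.Bijective (MSERel.map n φ h.mapsTo)) ∧
    (∀ (opR : MSERel n R I → MSERel n R I → MSERel n R I)
      (opA : MSERel n A J → MSERel n A J → MSERel n A J),
      FollowsVvRel I opR → FollowsVvRel J opA →
        (∀ x y : MSERel n A J, CommonTailRel J x y → MSERel.map n φ h.mapsTo (opA x y) =
          opR (MSERel.map n φ h.mapsTo x) (MSERel.map n φ h.mapsTo y)) ∧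
        (IsNiceRel J opA ↔ IsNiceRel I opR)) :=
  ⟨⟨mapF_bijective J hn, mapG_bijective J hn, map_zPlusMap_bijective hn h, mapG_bijective I hn,
    mapF_bijective I hn, map_bijective hn h⟩,
    fun _ _ hR hA => ⟨fun _ _ => map_op_of_commonTailRel hn h.mapsTo hA hR,
      isNiceRel_iff hn h hA hR⟩⟩

open Excision in
theorem mainTheorem6 {R : Type*} [CommRing R] (I : Ideal R) (n : ℕ) [NeZero n] (hn : 3 ≤ n) :
    (Function.Bijective (mapF (rIdeal I) n) ∧
      Function.Bijective (mapG (rIdeal I) n) ∧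
      Function.Bijective (mapPhi I n) ∧
      Function.Bijective (mapG I n) ∧
      Function.Bijective (mapF I n) ∧
      Function.Bijective (mapPi₂ I n)) ∧
    (∀ [Group (MSERel n R I)] [Group (MSERel n (RPlus I) (rIdeal I))],
      FollowsVvRel I (fun x y : MSERel n R I => x * y) →
      FollowsVvRel (rIdeal I) (fun x y : MSERel n (RPlus I) (rIdeal I) => x * y) →
        (∀ x y : MSERel n (RPlus I) (rIdeal I), CommonTailRel (rIdeal I) x y →
          mapPi₂ I n (x * y) = mapPi₂ I n x * mapPi₂ I n y) ∧
        ((∀ x y : MSERel n (RPlus I) (rIdeal I), CommonTailRel (rIdeal I) x y) →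
          ∃ ψ : MSERel n (RPlus I) (rIdeal I) →* MSERel n R I, ⇑ψ = mapPi₂ I n) ∧
        (IsNiceRel (rIdeal I) (fun x y : MSERel n (RPlus I) (rIdeal I) => x * y) ↔
          IsNiceRel I (fun x y : MSERel n R I => x * y))) := by
  have hgen := mainTheorem6_general (rHom I) (rIdeal I) I (bijOn_rHom I) n hn
  rw [← phi_eq_zPlusMap] at hgen
  refine ⟨hgen.1, fun hR hA => ?_⟩
  obtain ⟨hmul, hnice⟩ := hgen.2 _ _ hR hA
  exact ⟨hmul, fun hall => ⟨MonoidHom.mk' (mapPi₂ I n) fun x y => hmul x y (hall x y), rfl⟩, hnice⟩
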